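/- Let $p>0$ and let $A(t,x)=px+B(t,x)$ for $0\le t\le 1$, $x\in\mathbb R$, where $B:[0,1]\times\mathbb R\to\mathbb R$ is nonrandom, measurable in $t$, bounded, and differentiable in $x$, with $\sup_{0\le t\le1}\sup_{x}|B'_x(t,x)|<p$ and $$\lim_{r\to0}\ \sup_{0\le t\le1}\ \sup_{|x-y|\le r}|B'_x(t,x)-B'_x(t,y)|=0 .$$ Then there is a nonrandom $\varepsilon_0>0$ (depending only on $p$ and $B$) such that for every $0<\varepsilon\le\varepsilon_0$, every nonrandom $f\in L^1[0,1]$ and $\delta\in L^2[0,1]$, every standard Brownian motion $(W_t)_{0\le t\le1}$ on a probability space, and each of the three boundary conditions 1. Dirichlet: $x(0)=x(1)=0$, 2. Neumann: $\dot x(0)=\dot x(1)=0$, 3. periodic: $x(0)=x(1)$ and $\dot x(0)=\dot x(1)$, the stochastic equation $$d\dot x(t)=\varepsilon^2\big(A(t,x(t))+f(t)\big)\,dt+\varepsilon^2\delta(t)\,dW_t,\qquad 0\le t\le 1,$$ with that boundary condition has a unique strong solution with almost surely continuously differentiable paths. That is, there is a process $x$, measurable with respect to the completion of the $\sigma$-algebra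 generated by $(W_t)_{0\le t\le1}$, whose paths are a.s. continuously differentiable on $[0,1]$, which satisfies the boundary condition a.s., and for which a.s., for all $t\in[0,1]$, $$\dot x(t)=\dot x(0)+\varepsilon^2\int_0^t\big(A(s,x(s))+f(s)\big)\,ds+\varepsilon^2\int_0^t\delta(s)\,dW_s ;$$ and any two processes on the same probability space, with a.s. continuously differentiable paths, that satisfy this equation and the boundary condition a.s. coincide a.s. for all $t\in[0,1]$. -/

import Mathlib

open MeasureTheory ProbabilityTheory Filter Topology

namespace StochBVP

/-- `W` is a standard real Brownian motion on the time interval `[0,1]` under `P`. -/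
structure IsBrownianMotion {Ω : Type*} [MeasurableSpace Ω] (P : Measure Ω)
    (W : unitInterval → Ω → ℝ) : Prop where
  measurable : ∀ t, Measurable (W t)
  start : ∀ᵐ ω ∂P, W 0 ω = 0
  indep_increments : HasIndepIncrements W P
  gaussian_increments : ∀ s t : unitInterval, s ≤ t →
    HasLaw (fun ω => W t ω - W s ω) (gaussianReal 0 (Real.toNNReal ((t : ℝ) - (s : ℝ)))) P
  continuous_paths : ∀ᵐ ω ∂P, Continuous (fun t => W t ω)

/-- A deterministic step function `∑ i, c i * 1_{(a i, b i]}` on `[0,1]`. -/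
structure StepFunction where
  n : ℕ
  a : Fin n → unitInterval
  b : Fin n → unitInterval
  a_le_b : ∀ i, a i ≤ b i
  c : Fin n → ℝ

/-- The function on the line represented by a step function. -/
noncomputable def StepFunction.toFun (φ : StepFunction) (s : ℝ) : ℝ :=
  ∑ i, φ.c i * (Set.Ioc (φ.a i : ℝ) (φ.b i : ℝ)).indicator (fun _ => (1 : ℝ)) s

/-- The elementary integral `∑ i, c i * (W (b i) - W (a i))` of a step function. -/
noncomputable def StepFunction.integral {Ω : Type*} (φ : StepFunction)
    (W : unitInterval → Ω → ℝ) (ω : Ω) : ℝ :=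
  ∑ i, φ.c i * (W (φ.b i) ω - W (φ.a i) ω)

/-- `Z` is (a version of) the stochastic integral `∫₀¹ g dW` of the deterministic function `g`:
the limit in `L²(P)` of elementary integrals of step functions that converge to `g` in
`L²([0,1])`. -/
def IsWienerIntegral {Ω : Type*} [MeasurableSpace Ω] (P : Measure Ω)
    (W : unitInterval → Ω → ℝ) (g : ℝ → ℝ) (Z : Ω → ℝ) : Prop :=
  MemLp Z 2 P ∧ ∃ φ : ℕ → StepFunction,
    Tendsto (fun n => eLpNorm (fun s => (φ n).toFun s - g s) 2
      (volume.restrict (Set.Icc (0 : ℝ) 1))) atTop (𝓝 0) ∧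
    Tendsto (fun n => eLpNorm (fun ω => (φ n).integral W ω - Z ω) 2 P) atTop (𝓝 0)

/-- `M` is the (almost surely continuous) stochastic integral process
`M t = ∫₀ᵗ δ(s) dW_s`, `0 ≤ t ≤ 1`. The values of `M` off `[0,1]` play no role. -/
structure IsWienerIntegralProcess {Ω : Type*} [MeasurableSpace Ω] (P : Measure Ω)
    (W : unitInterval → Ω → ℝ) (δ : ℝ → ℝ) (M : ℝ → Ω → ℝ) : Prop where
  integral : ∀ t ∈ Set.Icc (0 : ℝ) 1, IsWienerIntegral P W ((Set.Icc 0 t).indicator δ) (M t)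
  continuous_paths : ∀ᵐ ω ∂P, ContinuousOn (fun t => M t ω) (Set.Icc 0 1)

/-- The path derivative `ẋ(t)` on `[0,1]` (one-sided at the end points). -/
noncomputable def velocity {Ω : Type*} (x : ℝ → Ω → ℝ) (t : ℝ) (ω : Ω) : ℝ :=
  derivWithin (fun s => x s ω) (Set.Icc 0 1) t

/-- The process `x` on `[0,1]` is a solution, with almost surely continuously differentiable
paths, of `dẋ(t) = ε² (A(t,x(t)) + f(t)) dt + ε² δ(t) dW_t`. The values of `x` off `[0,1]`
play no role. -/
structure IsSolution {Ω : Type*} [MeasurableSpace Ω] (P : Measure Ω)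
    (W : unitInterval → Ω → ℝ) (A : ℝ → ℝ → ℝ) (f δ : ℝ → ℝ) (ε : ℝ)
    (x : ℝ → Ω → ℝ) : Prop where
  aemeasurable : ∀ t ∈ Set.Icc (0 : ℝ) 1, AEMeasurable (x t) P
  contDiff : ∀ᵐ ω ∂P, ContDiffOn ℝ 1 (fun t => x t ω) (Set.Icc 0 1)
  integrable : ∀ᵐ ω ∂P, IntervalIntegrable (fun s => A s (x s ω) + f s) volume 0 1
  equation : ∃ M : ℝ → Ω → ℝ, IsWienerIntegralProcess P W δ M ∧
    ∀ᵐ ω ∂P, ∀ t ∈ Set.Icc (0 : ℝ) 1,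
      velocity x t ω = velocity x 0 ω
        + ε ^ 2 * (∫ s in (0 : ℝ)..t, (A s (x s ω) + f s)) + ε ^ 2 * M t ω

/-- A strong solution: a solution which is measurable with respect to the `P`-completion of the
σ-algebra generated by the driving Brownian motion `(W_t)_{0 ≤ t ≤ 1}`. (Because of the two-point
boundary conditions a solution at time `t` depends on the whole path of `W`.) -/
structure IsStrongSolution {Ω : Type*} [MeasurableSpace Ω] (P : Measure Ω)
    (W : unitInterval → Ω → ℝ) (A : ℝ → ℝ → ℝ) (f δ : ℝ → ℝ) (ε : ℝ)
    (x : ℝ → Ω → ℝ) : Prop extends IsSolution P W A f δ ε x where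
  strong : ∀ t ∈ Set.Icc (0 : ℝ) 1,
    AEStronglyMeasurable[⨆ s : unitInterval, MeasurableSpace.comap (W s) inferInstance] (x t) P

/-- The three types of boundary conditions. -/
inductive BoundaryType where
  | dirichlet
  | neumann
  | periodic

/-- The boundary conditions `x(0) = x(1) = 0`, `ẋ(0) = ẋ(1) = 0`, and
`x(0) = x(1), ẋ(0) = ẋ(1)` for the path of `x` at `ω`. -/
def BoundaryType.Holds {Ω : Type*} (bc : BoundaryType) (x : ℝ → Ω → ℝ) (ω : Ω) : Prop :=
  match bc with
  | .dirichlet => x 0 ω = 0 ∧ x 1 ω = 0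
  | .neumann => velocity x 0 ω = 0 ∧ velocity x 1 ω = 0
  | .periodic => x 0 ω = x 1 ω ∧ velocity x 0 ω = velocity x 1 ω

end StochBVP

/-! Put `k ^ 2 = ε ^ 2 * p`. Pathwise, the equation reads x'' = k²x + b(t,x) + N', where b = ε²B and
N = ε²(∫f + ∫δ dW) is a continuous path. By the mean value theorem b is Lipschitz in x with constant
l = ε²β < k². The maximum principle bounds solutions of z'' = k²z + h by sup|h|/k² under all three
boundary conditions (`abs_linear_bvp_le`). Freezing x inside b therefore gives a contraction with
ratio l/k² = β/p, whatever ε is. Since N is not differentiable, the linear problem is solved by a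
formula that only integrates N (`exists_linear_bvp`). The fixed point depends continuously on N
(`exists_solutionMap`), and the same estimate gives uniqueness (`path_solution_unique`).

The probabilistic part supplies N. The isometry and a Doob inequality for step functions, with
Borel–Cantelli, give a continuous version of ∫δ dW, unique up to indistinguishability. This version
is a random element of C([0,1]) measurable with respect to W
(`IsWienerIntegralProcess.exists_path`). A continuous functional of it keeps that measurability, so
the solution is strong. -/

namespace StochBVP


/-- The boundary conditions in terms of the end point values `x 0`, `x 1` of a path and
`v 0`, `v 1` of its derivative. -/
def BoundaryType.Cond (bc : BoundaryType) (x₀ x₁ v₀ v₁ : ℝ) : Prop :=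
  match bc with
  | .dirichlet => x₀ = 0 ∧ x₁ = 0
  | .neumann => v₀ = 0 ∧ v₁ = 0
  | .periodic => x₀ = x₁ ∧ v₀ = v₁

lemma BoundaryType.holds_iff {Ω : Type*} (bc : BoundaryType) (x : ℝ → Ω → ℝ) (ω : Ω) :
    bc.Holds x ω ↔ bc.Cond (x 0 ω) (x 1 ω) (velocity x 0 ω) (velocity x 1 ω) := by
  cases bc <;> rfl

lemma BoundaryType.Cond.sub {bc : BoundaryType} {x₀ x₁ v₀ v₁ y₀ y₁ w₀ w₁ : ℝ}
    (hx : bc.Cond x₀ x₁ v₀ v₁) (hy : bc.Cond y₀ y₁ w₀ w₁) :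
    bc.Cond (x₀ - y₀) (x₁ - y₁) (v₀ - w₀) (v₁ - w₁) := by
  cases bc <;> simp_all [BoundaryType.Cond]

lemma BoundaryType.Cond.neg {bc : BoundaryType} {x₀ x₁ v₀ v₁ : ℝ}
    (hx : bc.Cond x₀ x₁ v₀ v₁) : bc.Cond (-x₀) (-x₁) (-v₀) (-v₁) := by
  cases bc <;> simp_all [BoundaryType.Cond]

/-! ### Maximum principle for z'' = lam z + h -/

section MaximumPrinciple

variable {z v h : ℝ → ℝ} {lam H : ℝ}

/-- Where `z > H / lam` the integrand `lam * z + h` is positive, so the velocity strictly increases.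
Being nonnegative at `t₀`, it is positive just afterwards and `z` rises. Only the integrated
equation is used, so `h` need not be continuous. -/
lemma not_max_of_velocity_nonneg
    (hz : ∀ t ∈ Set.Icc (0 : ℝ) 1, HasDerivWithinAt z (v t) (Set.Icc 0 1) t)
    (hh : IntervalIntegrable h volume 0 1)
    (hv : ∀ t ∈ Set.Icc (0 : ℝ) 1, v t = v 0 + ∫ s in (0 : ℝ)..t, (lam * z s + h s))
    (hH : ∀ t ∈ Set.Icc (0 : ℝ) 1, |h t| ≤ H) (hlam : 0 < lam)
    {t₀ : ℝ} (h0 : 0 ≤ t₀) (h1 : t₀ < 1) (hpos : H / lam < z t₀) (hvt : 0 ≤ v t₀) :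
    ∃ t ∈ Set.Icc (0 : ℝ) 1, z t₀ < z t := by
  have hzc : ContinuousOn z (Set.Icc 0 1) := fun t ht => (hz t ht).continuousWithinAt
  have hint : IntervalIntegrable (fun s => lam * z s + h s) volume 0 1 := by
    refine IntervalIntegrable.add (ContinuousOn.intervalIntegrable ?_) hh
    rw [Set.uIcc_of_le zero_le_one]
    exact continuousOn_const.mul hzc
  have ev : ∀ᶠ t in 𝓝[Set.Icc 0 1] t₀, H / lam < z t :=
    (hzc t₀ ⟨h0, h1.le⟩).eventually (lt_mem_nhds hpos)
  obtain ⟨r, hr, hsub⟩ := Metric.mem_nhdsWithin_iff.1 ev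
  set t₁ := min 1 (t₀ + r / 2) with ht₁
  have h01 : t₀ < t₁ := lt_min h1 (by linarith)
  have ht₁1 : t₁ ≤ 1 := min_le_left _ _
  have hzpos : ∀ t ∈ Set.Icc t₀ t₁, H / lam < z t := by
    intro t ht
    have h2 : t ≤ t₀ + r / 2 := ht.2.trans (min_le_right _ _)
    refine hsub ⟨?_, h0.trans ht.1, ht.2.trans ht₁1⟩
    rw [Metric.mem_ball, Real.dist_eq, abs_lt]
    constructor <;> linarith [ht.1]
  have hvpos : ∀ t ∈ Set.Ioo t₀ t₁, 0 < v t := by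
    intro t ht
    have htm : t ∈ Set.Icc (0 : ℝ) 1 := ⟨h0.trans ht.1.le, ht.2.le.trans ht₁1⟩
    have hsub1 : Set.uIcc 0 t₀ ⊆ Set.uIcc (0 : ℝ) 1 := by
      rw [Set.uIcc_of_le h0, Set.uIcc_of_le zero_le_one]; exact Set.Icc_subset_Icc_right h1.le
    have hsub2 : Set.uIcc t₀ t ⊆ Set.uIcc (0 : ℝ) 1 := by
      rw [Set.uIcc_of_le ht.1.le, Set.uIcc_of_le zero_le_one]
      exact Set.Icc_subset_Icc h0 htm.2
    have hadd := intervalIntegral.integral_add_adjacent_intervals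
      (hint.mono_set hsub1) (hint.mono_set hsub2)
    have hp : 0 < ∫ s in t₀..t, (lam * z s + h s) := by
      refine intervalIntegral.intervalIntegral_pos_of_pos_on (hint.mono_set hsub2) ?_ ht.1
      intro s hs
      have h3 := hzpos s ⟨hs.1.le, hs.2.le.trans ht.2.le⟩
      have h4 := hH s ⟨h0.trans hs.1.le, hs.2.le.trans htm.2⟩
      rw [div_lt_iff₀ hlam] at h3
      have := (abs_le.1 h4).1
      nlinarith
    rw [hv t htm, ← hadd]
    have := hv t₀ ⟨h0, h1.le⟩
    linarith
  have hmono : StrictMonoOn z (Set.Icc t₀ t₁) := by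
    refine strictMonoOn_of_hasDerivWithinAt_pos (f' := v) (convex_Icc _ _)
      (hzc.mono (Set.Icc_subset_Icc h0 ht₁1)) ?_ ?_
    · intro t ht
      rw [interior_Icc] at ht ⊢
      exact (hz t ⟨h0.trans ht.1.le, ht.2.le.trans ht₁1⟩).mono
        (Set.Ioo_subset_Icc_self.trans (Set.Icc_subset_Icc h0 ht₁1))
    · intro t ht
      rw [interior_Icc] at ht
      exact hvpos t ht
  exact ⟨t₁, ⟨h0.trans h01.le, ht₁1⟩,
    hmono (Set.left_mem_Icc.2 h01.le) (Set.right_mem_Icc.2 h01.le) h01⟩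

/-- Time reversal `t ↦ 1 - t` preserves the second-order equation and flips the sign of the
velocity. -/
lemma not_max_of_velocity_nonpos
    (hz : ∀ t ∈ Set.Icc (0 : ℝ) 1, HasDerivWithinAt z (v t) (Set.Icc 0 1) t)
    (hh : IntervalIntegrable h volume 0 1)
    (hv : ∀ t ∈ Set.Icc (0 : ℝ) 1, v t = v 0 + ∫ s in (0 : ℝ)..t, (lam * z s + h s))
    (hH : ∀ t ∈ Set.Icc (0 : ℝ) 1, |h t| ≤ H) (hlam : 0 < lam)
    {t₀ : ℝ} (h0 : 0 < t₀) (h1 : t₀ ≤ 1) (hpos : H / lam < z t₀) (hvt : v t₀ ≤ 0) :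
    ∃ t ∈ Set.Icc (0 : ℝ) 1, z t₀ < z t := by
  have hmaps : Set.MapsTo (fun t : ℝ => 1 - t) (Set.Icc 0 1) (Set.Icc 0 1) := fun t ht =>
    ⟨by linarith [ht.2], by linarith [ht.1]⟩
  have hzc : ContinuousOn z (Set.Icc 0 1) := fun t ht => (hz t ht).continuousWithinAt
  have hint : IntervalIntegrable (fun s => lam * z s + h s) volume 0 1 := by
    refine IntervalIntegrable.add (ContinuousOn.intervalIntegrable ?_) hh
    rw [Set.uIcc_of_le zero_le_one]
    exact continuousOn_const.mul hzc
  obtain ⟨t, ht, hlt⟩ := not_max_of_velocity_nonneg (z := fun t => z (1 - t))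
    (v := fun t => -v (1 - t)) (h := fun t => h (1 - t)) (lam := lam) (H := H) (t₀ := 1 - t₀)
    (fun t ht => by
      have := (hz (1 - t) (hmaps ht)).comp t
        (((hasDerivAt_id t).const_sub 1).hasDerivWithinAt) hmaps
      exact this.congr_deriv (by simp))
    (by simpa using (hh.comp_sub_left 1).symm)
    (fun t ht => by
      have hsub1 : Set.uIcc 0 (1 - t) ⊆ Set.uIcc (0 : ℝ) 1 := by
        rw [Set.uIcc_of_le (hmaps ht).1, Set.uIcc_of_le zero_le_one]
        exact Set.Icc_subset_Icc_right (hmaps ht).2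
      have hsub2 : Set.uIcc (1 - t) 1 ⊆ Set.uIcc (0 : ℝ) 1 := by
        rw [Set.uIcc_of_le (hmaps ht).2, Set.uIcc_of_le zero_le_one]
        exact Set.Icc_subset_Icc_left (hmaps ht).1
      have hadd := intervalIntegral.integral_add_adjacent_intervals
        (hint.mono_set hsub1) (hint.mono_set hsub2)
      have e1 := intervalIntegral.integral_comp_sub_left (a := 0) (b := t)
        (fun s => lam * z s + h s) 1
      simp only [sub_zero] at e1 ⊢
      rw [e1, hv 1 ⟨zero_le_one, le_rfl⟩, hv (1 - t) (hmaps ht), ← hadd]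
      ring)
    (fun t ht => hH _ (hmaps ht)) hlam (by linarith) (by linarith) (by simpa using hpos)
    (by simpa using hvt)
  exact ⟨1 - t, hmaps ht, by simpa using hlt⟩

/-- A solution of the linear boundary value problem `z'' = lam z + h` with `|h| ≤ H` is bounded
above by `H / lam`. -/
lemma linear_bvp_le
    (hz : ∀ t ∈ Set.Icc (0 : ℝ) 1, HasDerivWithinAt z (v t) (Set.Icc 0 1) t)
    (hh : IntervalIntegrable h volume 0 1)
    (hv : ∀ t ∈ Set.Icc (0 : ℝ) 1, v t = v 0 + ∫ s in (0 : ℝ)..t, (lam * z s + h s))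
    (hH : ∀ t ∈ Set.Icc (0 : ℝ) 1, |h t| ≤ H) (hlam : 0 < lam) (bc : BoundaryType)
    (hbc : bc.Cond (z 0) (z 1) (v 0) (v 1)) :
    ∀ t ∈ Set.Icc (0 : ℝ) 1, z t ≤ H / lam := by
  have hzc : ContinuousOn z (Set.Icc 0 1) := fun t ht => (hz t ht).continuousWithinAt
  have hm0 : (0 : ℝ) ∈ Set.Icc (0 : ℝ) 1 := ⟨le_rfl, zero_le_one⟩
  have hm1 : (1 : ℝ) ∈ Set.Icc (0 : ℝ) 1 := ⟨zero_le_one, le_rfl⟩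
  obtain ⟨t₀, ht₀, hmax⟩ := isCompact_Icc.exists_isMaxOn ⟨0, hm0⟩ hzc
  have hH0 : 0 ≤ H / lam := div_nonneg ((abs_nonneg _).trans (hH 0 hm0)) hlam.le
  intro t ht
  by_contra! hlt
  have hpos : H / lam < z t₀ := hlt.trans_le (hmax ht)
  have hR : ∀ t₁ ∈ Set.Icc (0 : ℝ) 1, z t₁ = z t₀ → t₁ < 1 → 0 ≤ v t₁ → False := by
    intro t₁ ht₁ he hl hvv
    obtain ⟨s, hs, hs'⟩ := not_max_of_velocity_nonneg hz hh hv hH hlam ht₁.1 hl (he ▸ hpos) hvv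
    exact absurd (hmax hs) (by simpa [he] using hs')
  have hL : ∀ t₁ ∈ Set.Icc (0 : ℝ) 1, z t₁ = z t₀ → 0 < t₁ → v t₁ ≤ 0 → False := by
    intro t₁ ht₁ he hl hvv
    obtain ⟨s, hs, hs'⟩ := not_max_of_velocity_nonpos hz hh hv hH hlam hl ht₁.2 (he ▸ hpos) hvv
    exact absurd (hmax hs) (by simpa [he] using hs')
  -- The sign of `v t₀` says in which direction `z` would still grow. If that direction leaves the
  -- interval, the boundary condition helps: Dirichlet forces `z t₀ = 0`, Neumann gives zero
  -- velocity, so the inward direction works too, and periodicity moves the maximum to the other end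
  -- point with the same velocity.
  rcases le_total 0 (v t₀) with hv0 | hv0
  · rcases ht₀.2.lt_or_eq with hl | rfl
    · exact hR t₀ ht₀ rfl hl hv0
    · cases bc
      · linarith [hbc.2]
      · exact hL 1 hm1 rfl one_pos hbc.2.le
      · exact hR 0 hm0 hbc.1 one_pos (hbc.2 ▸ hv0)
  · rcases ht₀.1.lt_or_eq with hl | rfl
    · exact hL t₀ ht₀ rfl hl hv0
    · cases bc
      · linarith [hbc.1]
      · exact hR 0 hm0 rfl one_pos hbc.1.ge
      · exact hL 1 hm1 hbc.1.symm one_pos (hbc.2 ▸ hv0)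

/-- A solution of the linear boundary value problem `z'' = lam z + h` with `|h| ≤ H` satisfies
`|z| ≤ H / lam`. -/
lemma abs_linear_bvp_le
    (hz : ∀ t ∈ Set.Icc (0 : ℝ) 1, HasDerivWithinAt z (v t) (Set.Icc 0 1) t)
    (hh : IntervalIntegrable h volume 0 1)
    (hv : ∀ t ∈ Set.Icc (0 : ℝ) 1, v t = v 0 + ∫ s in (0 : ℝ)..t, (lam * z s + h s))
    (hH : ∀ t ∈ Set.Icc (0 : ℝ) 1, |h t| ≤ H) (hlam : 0 < lam) (bc : BoundaryType)
    (hbc : bc.Cond (z 0) (z 1) (v 0) (v 1)) :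
    ∀ t ∈ Set.Icc (0 : ℝ) 1, |z t| ≤ H / lam := by
  intro t ht
  refine abs_le'.2 ⟨linear_bvp_le hz hh hv hH hlam bc hbc t ht, ?_⟩
  refine linear_bvp_le (z := fun t => -z t) (v := fun t => -v t) (h := fun t => -h t)
    (fun t ht => (hz t ht).neg) hh.neg (fun t ht => ?_) (fun t ht => by simpa using hH t ht)
    hlam bc hbc.neg t ht
  rw [hv t ht, neg_add, ← intervalIntegral.integral_neg]
  congr 1
  refine intervalIntegral.integral_congr fun s _ => ?_
  ring

end MaximumPrinciple


/-! ### Explicit solution of the linear problem with continuous noise -/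

/-- Variation of constants for `x'' = k² x + N'` with a continuous `N`. -/
lemma hasDerivAt_variation {N : ℝ → ℝ} (hN : Continuous N) (k t : ℝ) :
    HasDerivAt (fun t => Real.cosh (k * t) * (∫ s in (0 : ℝ)..t, Real.cosh (k * s) * N s)
        - Real.sinh (k * t) * ∫ s in (0 : ℝ)..t, Real.sinh (k * s) * N s)
      (N t + k * (Real.sinh (k * t) * (∫ s in (0 : ℝ)..t, Real.cosh (k * s) * N s)
        - Real.cosh (k * t) * ∫ s in (0 : ℝ)..t, Real.sinh (k * s) * N s)) t ∧
    HasDerivAt (fun t => k * (Real.sinh (k * t) * (∫ s in (0 : ℝ)..t, Real.cosh (k * s) * N s)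
        - Real.cosh (k * t) * ∫ s in (0 : ℝ)..t, Real.sinh (k * s) * N s))
      (k ^ 2 * (Real.cosh (k * t) * (∫ s in (0 : ℝ)..t, Real.cosh (k * s) * N s)
        - Real.sinh (k * t) * ∫ s in (0 : ℝ)..t, Real.sinh (k * s) * N s)) t := by
  have hk : HasDerivAt (fun t : ℝ => k * t) k t := by
    simpa using (hasDerivAt_id t).const_mul k
  have hc : HasDerivAt (fun t => Real.cosh (k * t)) (Real.sinh (k * t) * k) t := hk.cosh
  have hs : HasDerivAt (fun t => Real.sinh (k * t)) (Real.cosh (k * t) * k) t := hk.sinh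
  have hP : HasDerivAt (fun t => ∫ s in (0 : ℝ)..t, Real.cosh (k * s) * N s)
      (Real.cosh (k * t) * N t) t :=
    (Continuous.integral_hasStrictDerivAt (by fun_prop) 0 t).hasDerivAt
  have hQ : HasDerivAt (fun t => ∫ s in (0 : ℝ)..t, Real.sinh (k * s) * N s)
      (Real.sinh (k * t) * N t) t :=
    (Continuous.integral_hasStrictDerivAt (by fun_prop) 0 t).hasDerivAt
  -- By the addition formulas the two functions are ∫cosh(k(t-s))N(s)ds and k∫sinh(k(t-s))N(s)ds
  -- over [0,t]. This is Duhamel's formula after an integration by parts, so `N` is never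
  -- differentiated. Expanding the kernels takes `t` out of the integrals, and the product rule
  -- suffices.
  have hid := Real.cosh_sq (k * t)
  constructor
  · refine ((hc.mul hP).sub (hs.mul hQ)).congr_deriv ?_
    linear_combination N t * hid
  · refine (((hs.mul hP).sub (hc.mul hQ)).const_mul k).congr_deriv ?_
    ring

lemma abs_integral_mul_le {c N : ℝ → ℝ} {K R t : ℝ} (ht : t ∈ Set.Icc (0 : ℝ) 1) (hK : 0 ≤ K)
    (hc : ∀ s ∈ Set.Icc (0 : ℝ) 1, |c s| ≤ K) (hR : ∀ s ∈ Set.Icc (0 : ℝ) 1, |N s| ≤ R) :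
    |∫ s in (0 : ℝ)..t, c s * N s| ≤ K * R := by
  have hR0 : 0 ≤ R := (abs_nonneg _).trans (hR 0 ⟨le_rfl, zero_le_one⟩)
  have := intervalIntegral.norm_integral_le_of_norm_le_const (a := 0) (b := t)
    (f := fun s => c s * N s) (C := K * R) (by
      intro s hs
      rw [Set.uIoc_of_le ht.1] at hs
      have hs' : s ∈ Set.Icc (0 : ℝ) 1 := ⟨hs.1.le, hs.2.trans ht.2⟩
      rw [Real.norm_eq_abs, abs_mul]
      exact mul_le_mul (hc s hs') (hR s hs') (abs_nonneg _) hK)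
  rw [Real.norm_eq_abs, sub_zero, abs_of_nonneg ht.1] at this
  exact this.trans (mul_le_of_le_one_right (mul_nonneg hK hR0) ht.2)

/-- Choice of the two free constants in the general solution of the linear equation. -/
lemma BoundaryType.exists_constants (bc : BoundaryType) {k : ℝ} (hk : 0 < k) :
    ∃ D, 0 ≤ D ∧ ∀ w v : ℝ, ∃ a b : ℝ,
      bc.Cond a (w + a * Real.cosh k + b * Real.sinh k) (k * b)
        (v + k * (a * Real.sinh k + b * Real.cosh k)) ∧
      |a| ≤ D * (|w| + |v|) ∧ |b| ≤ D * (|w| + |v|) := by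
  have hs : 0 < Real.sinh k := Real.sinh_pos_iff.2 hk
  have hc : 1 < Real.cosh k := Real.one_lt_cosh.2 hk.ne'
  have hid := Real.cosh_sq k
  cases bc
  · refine ⟨(Real.sinh k)⁻¹, by positivity, fun w v => ⟨0, -(w / Real.sinh k), ?_, ?_, ?_⟩⟩
    · refine ⟨rfl, ?_⟩
      field_simp
      ring
    · simp only [abs_zero]; positivity
    · rw [abs_neg, abs_div, abs_of_pos hs, div_eq_inv_mul]
      have := abs_nonneg v
      gcongr
      linarith
  · refine ⟨(k * Real.sinh k)⁻¹, by positivity,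
      fun w v => ⟨-(v / (k * Real.sinh k)), 0, ?_, ?_, ?_⟩⟩
    · refine ⟨by simp, ?_⟩
      field_simp
      ring
    · rw [abs_neg, abs_div, abs_of_pos (by positivity : 0 < k * Real.sinh k), div_eq_inv_mul]
      have := abs_nonneg w
      gcongr
      linarith
    · simp only [abs_zero]; positivity
  · have hc' : 0 < Real.cosh k - 1 := by linarith
    set c := Real.cosh k - 1 with hcdef
    set σ := Real.sinh k with hσ
    have hck : Real.cosh k = c + 1 := by rw [hcdef]; ring
    rw [hck] at hid ⊢
    -- Cramer's rule: the 2×2 system has determinant c² - σ² = -2c, nonzero because cosh k > 1. The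
    -- constant sums all the coefficients that occur, so it dominates each of them.
    refine ⟨(c + σ / k + c / k + σ) / (2 * c), by positivity, fun w v =>
      ⟨(w * c - v / k * σ) / (2 * c), (v / k * c - w * σ) / (2 * c), ⟨?_, ?_⟩, ?_, ?_⟩⟩
    · field_simp
      linear_combination -(w * k) * hid
    · field_simp
      linear_combination -v * hid
    · rw [abs_div, abs_of_pos (by positivity : 0 < 2 * c),
        div_mul_eq_mul_div (c + σ / k + c / k + σ)]
      refine div_le_div_of_nonneg_right ?_ (by positivity : 0 ≤ 2 * c)
      calc |w * c - v / k * σ| ≤ |w * c| + |v / k * σ| := abs_sub _ _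
        _ = c * |w| + σ / k * |v| := by
          rw [abs_mul, abs_mul, abs_div, abs_of_pos hc', abs_of_pos hs, abs_of_pos hk]; ring
        _ ≤ (c + σ / k + c / k + σ) * |w| + (c + σ / k + c / k + σ) * |v| := by
          have h1 : 0 < σ / k := by positivity
          have h2 : 0 < c / k := by positivity
          gcongr <;> linarith
        _ = _ := by ring
    · rw [abs_div, abs_of_pos (by positivity : 0 < 2 * c),
        div_mul_eq_mul_div (c + σ / k + c / k + σ)]
      refine div_le_div_of_nonneg_right ?_ (by positivity : 0 ≤ 2 * c)
      calc |v / k * c - w * σ| ≤ |v / k * c| + |w * σ| := abs_sub _ _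
        _ = σ * |w| + c / k * |v| := by
          rw [abs_mul, abs_mul, abs_div, abs_of_pos hc', abs_of_pos hs, abs_of_pos hk]; ring
        _ ≤ (c + σ / k + c / k + σ) * |w| + (c + σ / k + c / k + σ) * |v| := by
          have h1 : 0 < σ / k := by positivity
          have h2 : 0 < c / k := by positivity
          gcongr <;> linarith
        _ = _ := by ring

/-- Solvability of the linear boundary value problem `x'' = k² x + N'` with a continuous
inhomogeneity `N`. The derivative of the solution `x` is `N + V`. -/
lemma exists_linear_bvp (bc : BoundaryType) {k : ℝ} (hk : 0 < k) :
    ∃ C, 0 ≤ C ∧ ∀ (N : ℝ → ℝ) (R : ℝ), Continuous N → N 0 = 0 →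
      (∀ t ∈ Set.Icc (0 : ℝ) 1, |N t| ≤ R) →
      ∃ x V : ℝ → ℝ, (∀ t, HasDerivAt x (N t + V t) t) ∧
        (∀ t, HasDerivAt V (k ^ 2 * x t) t) ∧
        bc.Cond (x 0) (x 1) (N 0 + V 0) (N 1 + V 1) ∧
        ∀ t ∈ Set.Icc (0 : ℝ) 1, |x t| ≤ C * R := by
  obtain ⟨D, hD0, hD⟩ := bc.exists_constants hk
  set K := Real.cosh k with hK
  have hK1 : 1 ≤ K := Real.one_le_cosh k
  have hcosh : ∀ s ∈ Set.Icc (0 : ℝ) 1, |Real.cosh (k * s)| ≤ K := fun s hs => by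
    rw [abs_of_pos (Real.cosh_pos _), hK, Real.cosh_le_cosh, abs_of_pos hk,
      abs_of_nonneg (mul_nonneg hk.le hs.1)]
    exact mul_le_of_le_one_right hk.le hs.2
  have hsinh : ∀ s ∈ Set.Icc (0 : ℝ) 1, |Real.sinh (k * s)| ≤ K := fun s hs => by
    refine le_trans ?_ (hcosh s hs)
    rw [abs_of_pos (Real.cosh_pos _),
      abs_of_nonneg (Real.sinh_nonneg_iff.2 (mul_nonneg hk.le hs.1))]
    exact (Real.sinh_lt_cosh _).le
  -- The first term bounds the particular solution `w`. The factor after `D` bounds `|w 1| + |N 1 +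
  -- v 1|`, and `2 * K` accounts for the cosh and sinh terms.
  refine ⟨2 * K ^ 2 + 2 * K * (D * (2 * K ^ 2 + (1 + k * (2 * K ^ 2)))), by positivity,
    fun N R hN hN0 hR => ?_⟩
  have hR0 : 0 ≤ R := (abs_nonneg _).trans (hR 0 ⟨le_rfl, zero_le_one⟩)
  set w : ℝ → ℝ := fun t =>
    Real.cosh (k * t) * (∫ s in (0 : ℝ)..t, Real.cosh (k * s) * N s)
        - Real.sinh (k * t) * ∫ s in (0 : ℝ)..t, Real.sinh (k * s) * N s with hw
  set v : ℝ → ℝ := fun t =>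
    k * (Real.sinh (k * t) * (∫ s in (0 : ℝ)..t, Real.cosh (k * s) * N s)
        - Real.cosh (k * t) * ∫ s in (0 : ℝ)..t, Real.sinh (k * s) * N s) with hv
  have hcomb : ∀ t ∈ Set.Icc (0 : ℝ) 1, ∀ c s : ℝ, |c| ≤ K → |s| ≤ K →
      |c * (∫ s in (0 : ℝ)..t, Real.cosh (k * s) * N s)
        - s * ∫ s in (0 : ℝ)..t, Real.sinh (k * s) * N s| ≤ 2 * K ^ 2 * R := by
    intro t ht c s hc hs
    have h1 := abs_integral_mul_le ht (by positivity) hcosh hR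
    have h2 := abs_integral_mul_le ht (by positivity) hsinh hR
    calc _ ≤ _ := abs_sub _ _
      _ ≤ K * (K * R) + K * (K * R) := by rw [abs_mul, abs_mul]; gcongr
      _ = _ := by ring
  have hwb : ∀ t ∈ Set.Icc (0 : ℝ) 1, |w t| ≤ 2 * K ^ 2 * R := fun t ht =>
    hcomb t ht _ _ (hcosh t ht) (hsinh t ht)
  have hvb : |v 1| ≤ k * (2 * K ^ 2 * R) := by
    rw [hv, abs_mul, abs_of_pos hk]
    have hm : (1 : ℝ) ∈ Set.Icc (0 : ℝ) 1 := ⟨zero_le_one, le_rfl⟩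
    exact mul_le_mul_of_nonneg_left (hcomb 1 hm _ _ (hsinh 1 hm) (hcosh 1 hm)) hk.le
  obtain ⟨a, b, hab, ha, hb⟩ := hD (w 1) (N 1 + v 1)
  have hm1 : (1 : ℝ) ∈ Set.Icc (0 : ℝ) 1 := ⟨zero_le_one, le_rfl⟩
  have hsum : |w 1| + |N 1 + v 1| ≤ (2 * K ^ 2 + (1 + k * (2 * K ^ 2))) * R := by
    have := abs_add_le (N 1) (v 1)
    linarith [hwb 1 hm1, hR 1 hm1]
  refine ⟨fun t => w t + a * Real.cosh (k * t) + b * Real.sinh (k * t),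
    fun t => v t + k * (a * Real.sinh (k * t) + b * Real.cosh (k * t)), fun t => ?_, fun t => ?_,
    ?_, fun t ht => ?_⟩
  · have hkt : HasDerivAt (fun t : ℝ => k * t) k t := by
      simpa using (hasDerivAt_id t).const_mul k
    refine (((hasDerivAt_variation hN k t).1.add (hkt.cosh.const_mul a)).add
      (hkt.sinh.const_mul b)).congr_deriv ?_
    simp only [hv]
    ring
  · have hkt : HasDerivAt (fun t : ℝ => k * t) k t := by
      simpa using (hasDerivAt_id t).const_mul k
    refine ((hasDerivAt_variation hN k t).2.add (((hkt.sinh.const_mul a).add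
      (hkt.cosh.const_mul b)).const_mul k)).congr_deriv ?_
    simp only [hw]
    ring
  · convert hab using 1
    · simp [hw]
    · simp only [mul_one]; rfl
    · simp [hv, hN0]
    · simp only [mul_one]; ring
  · calc |w t + a * Real.cosh (k * t) + b * Real.sinh (k * t)|
        ≤ |w t| + |a| * |Real.cosh (k * t)| + |b| * |Real.sinh (k * t)| := by
          rw [← abs_mul, ← abs_mul]
          exact abs_add_three _ _ _
      _ ≤ 2 * K ^ 2 * R + (D * ((2 * K ^ 2 + (1 + k * (2 * K ^ 2))) * R)) * K
          + (D * ((2 * K ^ 2 + (1 + k * (2 * K ^ 2))) * R)) * K := by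
          have ha' := ha.trans (mul_le_mul_of_nonneg_left hsum hD0)
          have hb' := hb.trans (mul_le_mul_of_nonneg_left hsum hD0)
          have h1 := hcosh t ht
          have h2 := hsinh t ht
          have h3 := hwb t ht
          gcongr
      _ = _ := by ring


/-! ### The deterministic nonlinear problem and its solution map -/

/-- `x` solves `x'' = a(t, x) + N'` with the boundary condition `bc`, and `v` is its derivative. -/
structure IsPathSolution (bc : BoundaryType) (a : ℝ → ℝ → ℝ) (N x v : ℝ → ℝ) : Prop where
  hasDeriv : ∀ t ∈ Set.Icc (0 : ℝ) 1, HasDerivWithinAt x (v t) (Set.Icc 0 1) t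
  equation : ∀ t ∈ Set.Icc (0 : ℝ) 1, v t = v 0 + (∫ s in (0 : ℝ)..t, a s (x s)) + N t
  cond : bc.Cond (x 0) (x 1) (v 0) (v 1)

lemma IsPathSolution.continuousOn {bc : BoundaryType} {a : ℝ → ℝ → ℝ} {N x v : ℝ → ℝ}
    (h : IsPathSolution bc a N x v) : ContinuousOn x (Set.Icc 0 1) :=
  fun t ht => (h.hasDeriv t ht).continuousWithinAt

lemma uIcc_zero_subset {t : ℝ} (ht : t ∈ Set.Icc (0 : ℝ) 1) :
    Set.uIcc 0 t ⊆ Set.uIcc (0 : ℝ) 1 := by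
  rw [Set.uIcc_of_le ht.1, Set.uIcc_of_le zero_le_one]
  exact Set.Icc_subset_Icc_right ht.2

lemma continuous_primitive {h : ℝ → ℝ} (hh : IntervalIntegrable h volume 0 1) :
    Continuous (Set.IccExtend (zero_le_one (α := ℝ))
      fun t : unitInterval => ∫ s in (0 : ℝ)..t, h s) := by
  refine Continuous.Icc_extend' ?_
  have := intervalIntegral.continuousOn_primitive_interval (μ := volume) (a := (0 : ℝ)) (b := 1)
    (f := h) (by
      rw [Set.uIcc_of_le zero_le_one]
      exact (intervalIntegrable_iff_integrableOn_Icc_of_le zero_le_one).1 hh)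
  rw [Set.uIcc_of_le zero_le_one] at this
  exact continuousOn_iff_continuous_domRestrict.1 this

/-- An integrable forcing `h` is absorbed into the noise through its continuous primitive, which
reduces the problem to the explicit formula. -/
lemma exists_path_solution_linear (bc : BoundaryType) {k : ℝ} (hk : 0 < k) {h N : ℝ → ℝ}
    (hh : IntervalIntegrable h volume 0 1) (hN : Continuous N) (hN0 : N 0 = 0) :
    ∃ x v, Continuous x ∧ Continuous v ∧
      IsPathSolution bc (fun s y => k ^ 2 * y + h s) N x v := by
  obtain ⟨C, -, hC⟩ := exists_linear_bvp bc hk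
  set J := Set.IccExtend (zero_le_one (α := ℝ))
    fun t : unitInterval => ∫ s in (0 : ℝ)..t, h s with hJ
  have hJc : Continuous J := continuous_primitive hh
  have hJt : ∀ t ∈ Set.Icc (0 : ℝ) 1, J t = ∫ s in (0 : ℝ)..t, h s := fun t ht => by
    rw [hJ, Set.IccExtend_of_mem _ _ ht]
  have hJ0 : J 0 = 0 := by rw [hJt 0 ⟨le_rfl, zero_le_one⟩]; simp
  obtain ⟨R, hR⟩ := isCompact_Icc.exists_bound_of_continuousOn (s := Set.Icc (0 : ℝ) 1)
    (hJc.add hN).continuousOn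
  obtain ⟨x, V, hx, hV, hcond, -⟩ := hC (fun t => J t + N t) R (hJc.add hN) (by simp [hJ0, hN0]) hR
  have hxc : Continuous x := continuous_iff_continuousAt.2 fun t => (hx t).continuousAt
  have hVc : Continuous V := continuous_iff_continuousAt.2 fun t => (hV t).continuousAt
  refine ⟨x, fun t => J t + N t + V t, hxc, (hJc.add hN).add hVc,
    fun t ht => (hx t).hasDerivWithinAt, fun t ht => ?_, hcond⟩
  have hi := intervalIntegral.integral_eq_sub_of_hasDerivAt (a := 0) (b := t)
    (fun s _ => hV s) ((continuous_const.mul hxc).intervalIntegrable _ _)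
  have hkx : Continuous fun s => k ^ 2 * x s := continuous_const.mul hxc
  rw [intervalIntegral.integral_add (hkx.intervalIntegrable _ _)
    (hh.mono_set (uIcc_zero_subset ht)), hi, hJt t ht, hJ0, hN0]
  ring

/-- A priori estimate for the difference of two solutions with different noises. -/
lemma exists_path_solution_estimate (bc : BoundaryType) {k : ℝ} (hk : 0 < k) :
    ∃ C, 0 ≤ C ∧ ∀ (N : ℝ → ℝ) (R H : ℝ) (h z v : ℝ → ℝ), Continuous N → N 0 = 0 →
      (∀ t ∈ Set.Icc (0 : ℝ) 1, |N t| ≤ R) → IntervalIntegrable h volume 0 1 →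
      (∀ t ∈ Set.Icc (0 : ℝ) 1, |h t| ≤ H) →
      IsPathSolution bc (fun s y => k ^ 2 * y + h s) N z v →
      ∀ t ∈ Set.Icc (0 : ℝ) 1, |z t| ≤ H / k ^ 2 + C * R := by
  obtain ⟨C, hC0, hC⟩ := exists_linear_bvp bc hk
  refine ⟨C, hC0, fun N R H h z v hN hN0 hR hh hH hz t ht => ?_⟩
  obtain ⟨x, V, hx, hV, hcond, hb⟩ := hC N R hN hN0 hR
  have hxc : Continuous x := continuous_iff_continuousAt.2 fun t => (hx t).continuousAt
  have key := abs_linear_bvp_le (z := fun t => z t - x t) (v := fun t => v t - (N t + V t))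
    (h := h) (lam := k ^ 2) (H := H)
    (fun t ht => (hz.hasDeriv t ht).sub (hx t).hasDerivWithinAt) hh
    (fun t ht => by
      have hi := intervalIntegral.integral_eq_sub_of_hasDerivAt (a := 0) (b := t)
        (fun s _ => hV s) ((continuous_const.mul hxc).intervalIntegrable _ _)
      have hzi : IntervalIntegrable (fun s => k ^ 2 * z s + h s) volume 0 t := by
        refine (IntervalIntegrable.add (ContinuousOn.intervalIntegrable ?_) hh).mono_set
          (uIcc_zero_subset ht)
        rw [Set.uIcc_of_le zero_le_one]
        exact continuousOn_const.mul hz.continuousOn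
      have he : (∫ s in (0 : ℝ)..t, (k ^ 2 * (z s - x s) + h s))
          = (∫ s in (0 : ℝ)..t, (k ^ 2 * z s + h s)) - ∫ s in (0 : ℝ)..t, k ^ 2 * x s := by
        have hkx : Continuous fun s => k ^ 2 * x s := continuous_const.mul hxc
        rw [← intervalIntegral.integral_sub hzi (hkx.intervalIntegrable _ _)]
        exact intervalIntegral.integral_congr fun s _ => by ring
      rw [he, hi, hz.equation t ht, hN0]
      ring)
    hH (by positivity) bc (hz.cond.sub hcond) t ht
  have := abs_sub_abs_le_abs_sub (z t) (x t)
  linarith [hb t ht]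

/-- The extension of a path on the unit interval to the real line. -/
noncomputable def pathExtend (y : C(unitInterval, ℝ)) : ℝ → ℝ := Set.IccExtend zero_le_one y

lemma continuous_pathExtend (y : C(unitInterval, ℝ)) : Continuous (pathExtend y) :=
  y.continuous.Icc_extend'

lemma pathExtend_apply (y : C(unitInterval, ℝ)) {t : ℝ} (ht : t ∈ Set.Icc (0 : ℝ) 1) :
    pathExtend y t = y ⟨t, ht⟩ := Set.IccExtend_of_mem _ _ ht

lemma abs_pathExtend_sub_le (y z : C(unitInterval, ℝ)) (t : ℝ) :
    |pathExtend y t - pathExtend z t| ≤ dist y z := by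
  rw [← Real.dist_eq]
  exact ContinuousMap.dist_apply_le_dist _

lemma IsPathSolution.congr {bc : BoundaryType} {a : ℝ → ℝ → ℝ} {N x v y : ℝ → ℝ}
    (h : IsPathSolution bc a N x v) (hy : ∀ t ∈ Set.Icc (0 : ℝ) 1, y t = x t) :
    IsPathSolution bc a N y v where
  hasDeriv t ht := (h.hasDeriv t ht).congr hy (hy t ht)
  equation t ht := by
    rw [h.equation t ht]
    congr 2
    refine intervalIntegral.integral_congr fun s hs => ?_
    have := uIcc_zero_subset ht hs
    rw [Set.uIcc_of_le zero_le_one] at this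
    simp only [hy s this]
  cond := by
    rw [hy 0 ⟨le_rfl, zero_le_one⟩, hy 1 ⟨zero_le_one, le_rfl⟩]
    exact h.cond

/-- With the nonlinearity frozen as a forcing, the problem is linear. Both the contraction estimate
and uniqueness compare solutions in this form. -/
lemma IsPathSolution.sub {bc : BoundaryType} {k : ℝ} {b₁ b₂ N₁ N₂ x₁ x₂ v₁ v₂ : ℝ → ℝ}
    (h₁ : IsPathSolution bc (fun s y => k ^ 2 * y + b₁ s) N₁ x₁ v₁)
    (h₂ : IsPathSolution bc (fun s y => k ^ 2 * y + b₂ s) N₂ x₂ v₂)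
    (hb₁ : IntervalIntegrable b₁ volume 0 1) (hb₂ : IntervalIntegrable b₂ volume 0 1) :
    IsPathSolution bc (fun s y => k ^ 2 * y + (b₁ s - b₂ s)) (fun t => N₁ t - N₂ t)
      (fun t => x₁ t - x₂ t) (fun t => v₁ t - v₂ t) where
  hasDeriv t ht := (h₁.hasDeriv t ht).sub (h₂.hasDeriv t ht)
  equation t ht := by
    have hi : ∀ x b : ℝ → ℝ, ContinuousOn x (Set.Icc 0 1) → IntervalIntegrable b volume 0 1 →
        IntervalIntegrable (fun s => k ^ 2 * x s + b s) volume 0 t := by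
      intro x b hx hb
      refine (IntervalIntegrable.add (ContinuousOn.intervalIntegrable ?_) hb).mono_set
          (uIcc_zero_subset ht)
      rw [Set.uIcc_of_le zero_le_one]
      exact continuousOn_const.mul hx
    have he : (∫ s in (0 : ℝ)..t, (k ^ 2 * (x₁ s - x₂ s) + (b₁ s - b₂ s)))
        = (∫ s in (0 : ℝ)..t, (k ^ 2 * x₁ s + b₁ s))
          - ∫ s in (0 : ℝ)..t, (k ^ 2 * x₂ s + b₂ s) := by
      rw [← intervalIntegral.integral_sub (hi _ _ h₁.continuousOn hb₁) (hi _ _ h₂.continuousOn hb₂)]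
      exact intervalIntegral.integral_congr fun s _ => by ring
    rw [he, h₁.equation t ht, h₂.equation t ht]
    ring
  cond := h₁.cond.sub h₂.cond

/-- The solution map of the boundary value problem `x'' = k² x + b(t, x) + N'`, as a continuous
function of the noise path `N`. -/
theorem exists_solutionMap (bc : BoundaryType) {k l : ℝ} (hk : 0 < k) (hl0 : 0 ≤ l)
    (hl : l < k ^ 2) {b : ℝ → ℝ → ℝ}
    (hb : ∀ y : ℝ → ℝ, Continuous y → IntervalIntegrable (fun s => b s (y s)) volume 0 1)
    (hlip : ∀ t ∈ Set.Icc (0 : ℝ) 1, ∀ x y, |b t x - b t y| ≤ l * |x - y|) :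
    ∃ Φ : C(unitInterval, ℝ) → C(unitInterval, ℝ), Continuous Φ ∧
      ∀ N, ∃ v, Continuous v ∧ IsPathSolution bc (fun s y => k ^ 2 * y + b s y)
        (fun t => pathExtend N t - N 0) (pathExtend (Φ N)) v := by
  have hk2 : 0 < k ^ 2 := by positivity
  obtain ⟨C, hC0, hC⟩ := exists_path_solution_estimate bc hk
  have hNc : ∀ N : C(unitInterval, ℝ), Continuous fun t => pathExtend N t - N 0 := fun N =>
    (continuous_pathExtend N).sub continuous_const
  have hN0 : ∀ N : C(unitInterval, ℝ), pathExtend N 0 - N 0 = 0 := fun N => by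
    rw [pathExtend_apply N (t := 0) ⟨le_rfl, zero_le_one⟩]
    exact sub_self _
  have hext : ∀ N (y : C(unitInterval, ℝ)), ∃ x : C(unitInterval, ℝ), ∃ v, Continuous v ∧
      IsPathSolution bc (fun s u => k ^ 2 * u + b s (pathExtend y s))
        (fun t => pathExtend N t - N 0) (pathExtend x) v := by
    intro N y
    obtain ⟨x, v, hx, hv, hs⟩ := exists_path_solution_linear bc hk
      (hb _ (continuous_pathExtend y)) (hNc N) (hN0 N)
    exact ⟨⟨fun t => x t, by fun_prop⟩, v, hv, hs.congr fun t ht => by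
      rw [pathExtend_apply _ ht]; rfl⟩
  choose T hT using hext
  have hdist : ∀ N N' y y', dist (T N y) (T N' y') ≤ l / k ^ 2 * dist y y' + 2 * C * dist N N' := by
    intro N N' y y'
    obtain ⟨v, -, hv⟩ := hT N y
    obtain ⟨v', -, hv'⟩ := hT N' y'
    refine (ContinuousMap.dist_le (by positivity)).2 fun t => ?_
    -- The factor 2 comes from recentring the noises at their values at 0.
    have := hC _ (2 * dist N N') (l * dist y y') _ _ _ ((hNc N).sub (hNc N'))
      (by rw [Pi.sub_apply, hN0, hN0, sub_zero])
      (fun t _ => by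
        have h1 := abs_pathExtend_sub_le N N' t
        have h2 : |N 0 - N' 0| ≤ dist N N' := by
          rw [← Real.dist_eq]; exact ContinuousMap.dist_apply_le_dist _
        calc |pathExtend N t - N 0 - (pathExtend N' t - N' 0)|
            = |(pathExtend N t - pathExtend N' t) - (N 0 - N' 0)| := by congr 1; ring
          _ ≤ _ := abs_sub _ _
          _ ≤ _ := by linarith)
      ((hb _ (continuous_pathExtend y)).sub (hb _ (continuous_pathExtend y')))
      (fun t ht => (hlip t ht _ _).trans
        (mul_le_mul_of_nonneg_left (abs_pathExtend_sub_le y y' t) hl0))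
      (hv.sub hv' (hb _ (continuous_pathExtend y)) (hb _ (continuous_pathExtend y'))) t t.2
    rw [pathExtend_apply _ t.2, pathExtend_apply _ t.2] at this
    rw [Real.dist_eq]
    refine this.trans (le_of_eq ?_)
    ring
  have hq0 : 0 ≤ l / k ^ 2 := by positivity
  have hq1 : l / k ^ 2 < 1 := (div_lt_one hk2).2 hl
  have hcontr : ∀ N, ContractingWith (NNReal.mk (l / k ^ 2) hq0) (T N) := fun N =>
    ⟨by exact_mod_cast hq1, LipschitzWith.of_dist_le_mul fun y y' => by
      simpa using hdist N N y y'⟩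
  have hfix : ∀ N, T N ((hcontr N).fixedPoint (T N)) = (hcontr N).fixedPoint (T N) := fun N =>
    (hcontr N).fixedPoint_isFixedPt
  refine ⟨fun N => (hcontr N).fixedPoint (T N), ?_, fun N => ?_⟩
  -- At the fixed points `hdist` reads d ≤ (l/k²)d + 2C·dist N N'; solving for d gives this
  -- Lipschitz constant.
  · have hK : 0 ≤ 2 * C / (1 - l / k ^ 2) := div_nonneg (by positivity) (by linarith)
    refine (LipschitzWith.of_dist_le_mul (K := NNReal.mk _ hK) fun N N' => ?_).continuous
    have := hdist N N' ((hcontr N).fixedPoint (T N)) ((hcontr N').fixedPoint (T N'))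
    rw [hfix, hfix] at this
    rw [NNReal.coe_mk, div_mul_eq_mul_div, le_div_iff₀ (by linarith)]
    linarith
  · obtain ⟨v, hvc, hv⟩ := hT N ((hcontr N).fixedPoint (T N))
    rw [hfix] at hv
    exact ⟨v, hvc, hv.hasDeriv, hv.equation, hv.cond⟩

/-- Uniqueness for the boundary value problem. -/
lemma path_solution_unique (bc : BoundaryType) {k l : ℝ} (hk : 0 < k) (hl0 : 0 ≤ l)
    (hl : l < k ^ 2) {b : ℝ → ℝ → ℝ}
    (hlip : ∀ t ∈ Set.Icc (0 : ℝ) 1, ∀ x y, |b t x - b t y| ≤ l * |x - y|) {g N x y v w : ℝ → ℝ}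
    (hx : IsPathSolution bc (fun s u => k ^ 2 * u + (b s u + g s)) N x v)
    (hy : IsPathSolution bc (fun s u => k ^ 2 * u + (b s u + g s)) N y w)
    (hix : IntervalIntegrable (fun s => b s (x s) + g s) volume 0 1)
    (hiy : IntervalIntegrable (fun s => b s (y s) + g s) volume 0 1) :
    ∀ t ∈ Set.Icc (0 : ℝ) 1, x t = y t := by
  have hk2 : 0 < k ^ 2 := by positivity
  have hx' : IsPathSolution bc (fun s u => k ^ 2 * u + (b s (x s) + g s)) N x v :=
    ⟨hx.hasDeriv, hx.equation, hx.cond⟩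
  have hy' : IsPathSolution bc (fun s u => k ^ 2 * u + (b s (y s) + g s)) N y w :=
    ⟨hy.hasDeriv, hy.equation, hy.cond⟩
  have hs := hx'.sub hy' hix hiy
  obtain ⟨t₀, ht₀, hmax⟩ := isCompact_Icc.exists_isMaxOn ⟨0, ⟨le_rfl, zero_le_one⟩⟩
    (hs.continuousOn.abs)
  -- At the point where |x - y| is largest the bound reads m ≤ (l/k²)m, which forces m = 0.
  have key := abs_linear_bvp_le (H := l * |x t₀ - y t₀|) hs.hasDeriv (hix.sub hiy)
    (fun t ht => by simpa using hs.equation t ht)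
    (fun t ht => by
      rw [add_sub_add_right_eq_sub]
      exact (hlip t ht _ _).trans (mul_le_mul_of_nonneg_left (hmax ht) hl0)) hk2 bc hs.cond t₀ ht₀
  have hz : |x t₀ - y t₀| = 0 := by
    by_contra hne
    have hpos : 0 < |x t₀ - y t₀| := lt_of_le_of_ne (abs_nonneg _) (Ne.symm hne)
    rw [le_div_iff₀ hk2] at key
    nlinarith
  intro t ht
  have : |x t - y t| ≤ 0 := hz ▸ hmax ht
  exact sub_eq_zero.1 (abs_nonpos_iff.1 this)


/-! ### The Wiener isometry for step functions -/

section Isometry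

lemma eLpNorm_two_congr {α β : Type*} [MeasurableSpace α] [MeasurableSpace β] {μ : Measure α}
    {ν : Measure β} {F : α → ℝ} {G : β → ℝ} (hF : MemLp F 2 μ) (hG : MemLp G 2 ν)
    (h : ∫ x, F x * F x ∂μ = ∫ y, G y * G y ∂ν) : eLpNorm F 2 μ = eLpNorm G 2 ν := by
  rw [hF.eLpNorm_eq_integral_rpow_norm (by simp) (by simp),
    hG.eLpNorm_eq_integral_rpow_norm (by simp) (by simp)]
  simp only [ENNReal.toReal_ofNat, Real.rpow_ofNat, Real.norm_eq_abs, sq_abs]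
  simp only [sq, h]

/-- The second moment of a linear combination of increments of a process `g` with covariance
`min u v`. -/
lemma integral_sum_increments {α : Type*} [MeasurableSpace α] {μ : Measure α}
    {g : unitInterval → α → ℝ} (hg : ∀ u, MemLp (g u) 2 μ)
    (hcov : ∀ u v, ∫ x, g u x * g v x ∂μ = min (u : ℝ) v) {ι : Type*} [Fintype ι] (c : ι → ℝ)
    (a b : ι → unitInterval) :
    ∫ x, (∑ i, c i * (g (b i) x - g (a i) x)) * (∑ i, c i * (g (b i) x - g (a i) x)) ∂μ
      = ∑ i, ∑ j, c i * c j * (min (b i : ℝ) (b j) - min (b i : ℝ) (a j)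
        - min (a i : ℝ) (b j) + min (a i : ℝ) (a j)) := by
  have hint : ∀ u v, Integrable (fun x => g u x * g v x) μ := fun u v =>
    (hg u).integrable_mul (hg v)
  have hexp : ∀ x, (∑ i, c i * (g (b i) x - g (a i) x)) * (∑ i, c i * (g (b i) x - g (a i) x))
      = ∑ i, ∑ j, c i * c j * (g (b i) x * g (b j) x - g (b i) x * g (a j) x
        - g (a i) x * g (b j) x + g (a i) x * g (a j) x) := fun x => by
    rw [Finset.sum_mul_sum]
    exact Finset.sum_congr rfl fun i _ => Finset.sum_congr rfl fun j _ => by ring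
  simp only [hexp]
  have hI : ∀ i j, Integrable (fun x => c i * c j * (g (b i) x * g (b j) x - g (b i) x * g (a j) x
        - g (a i) x * g (b j) x + g (a i) x * g (a j) x)) μ := fun i j =>
    ((((hint _ _).sub (hint _ _)).sub (hint _ _)).add (hint _ _)).const_mul _
  rw [integral_finsetSum _ fun i _ => integrable_finsetSum _ fun j _ => hI i j]
  refine Finset.sum_congr rfl fun i _ => ?_
  rw [integral_finsetSum _ fun j _ => hI i j]
  refine Finset.sum_congr rfl fun j _ => ?_
  have h1 : Integrable (fun x => g (b i) x * g (b j) x - g (b i) x * g (a j) x) μ :=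
    (hint _ _).sub (hint _ _)
  have h2 : Integrable (fun x => g (b i) x * g (b j) x - g (b i) x * g (a j) x
      - g (a i) x * g (b j) x) μ := h1.sub (hint _ _)
  rw [integral_const_mul, integral_add h2 (hint _ _), integral_sub h1 (hint _ _),
    integral_sub (hint _ _) (hint _ _)]
  simp only [hcov]

lemma memLp_indicator_Ioc (u : unitInterval) :
    MemLp ((Set.Ioc (0 : ℝ) u).indicator fun _ => (1 : ℝ)) 2
      (volume.restrict (Set.Icc (0 : ℝ) 1)) :=
  memLp_indicator_const 2 measurableSet_Ioc 1 (Or.inr (measure_ne_top _ _))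

/-- The indicators of (0,u] have the same covariance as Brownian motion; this is the deterministic
half of the isometry. -/
lemma integral_indicator_Ioc_mul (u v : unitInterval) :
    ∫ s in Set.Icc (0 : ℝ) 1, (Set.Ioc (0 : ℝ) u).indicator (fun _ => (1 : ℝ)) s *
      (Set.Ioc (0 : ℝ) v).indicator (fun _ => (1 : ℝ)) s = min (u : ℝ) v := by
  have h : ∀ s, (Set.Ioc (0 : ℝ) u).indicator (fun _ => (1 : ℝ)) s *
      (Set.Ioc (0 : ℝ) v).indicator (fun _ => (1 : ℝ)) s
      = (Set.Ioc (0 : ℝ) (min (u : ℝ) v)).indicator (fun _ => (1 : ℝ)) s := fun s => by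
    rw [← Set.inter_indicator_mul, Set.Ioc_inter_Ioc]
    simp
  simp only [h]
  rw [integral_indicator measurableSet_Ioc, Measure.restrict_restrict measurableSet_Ioc,
    Set.inter_eq_left.2 (show Set.Ioc (0 : ℝ) (min (u : ℝ) v) ⊆ Set.Icc 0 1 from
      fun s hs => ⟨hs.1.le, hs.2.trans ((min_le_left _ _).trans u.2.2)⟩)]
  simp only [integral_const, smul_eq_mul, mul_one, measureReal_restrict_apply_univ,
    Real.volume_real_Ioc]
  have : 0 ≤ min (u : ℝ) v := le_min u.2.1 v.2.1
  simp [this]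

lemma StepFunction.toFun_eq (φ : StepFunction) (s : ℝ) :
    φ.toFun s = ∑ i, φ.c i * ((Set.Ioc (0 : ℝ) (φ.b i)).indicator (fun _ => (1 : ℝ)) s
      - (Set.Ioc (0 : ℝ) (φ.a i)).indicator (fun _ => (1 : ℝ)) s) := by
  refine Finset.sum_congr rfl fun i _ => ?_
  congr 1
  have h1 : (φ.a i : ℝ) ≤ φ.b i := φ.a_le_b i
  have h2 : (0 : ℝ) ≤ φ.a i := (φ.a i).2.1
  simp only [Set.indicator_apply, Set.mem_Ioc]
  grind

lemma StepFunction.memLp_toFun (φ : StepFunction) :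
    MemLp φ.toFun 2 (volume.restrict (Set.Icc (0 : ℝ) 1)) := by
  have : φ.toFun = fun s => ∑ i, φ.c i * ((Set.Ioc (0 : ℝ) (φ.b i)).indicator (fun _ => (1 : ℝ)) s
      - (Set.Ioc (0 : ℝ) (φ.a i)).indicator (fun _ => (1 : ℝ)) s) := funext φ.toFun_eq
  rw [this]
  exact memLp_finsetSum _ fun i _ =>
    ((memLp_indicator_Ioc _).sub (memLp_indicator_Ioc _)).const_mul _

variable {Ω : Type*} [MeasurableSpace Ω] {P : Measure Ω} {W : unitInterval → Ω → ℝ}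

lemma IsBrownianMotion.memLp_increment (hW : IsBrownianMotion P W) {s t : unitInterval}
    (hst : s ≤ t) : MemLp (fun ω => W t ω - W s ω) 2 P := by
  have h := hW.gaussian_increments s t hst
  have h2 : MemLp id 2 (gaussianReal 0 (Real.toNNReal ((t : ℝ) - s))) := memLp_id_gaussianReal 2
  rw [← h.map_eq, memLp_map_measure_iff (by fun_prop) h.aemeasurable] at h2
  exact h2

lemma IsBrownianMotion.integral_increment (hW : IsBrownianMotion P W) {s t : unitInterval}
    (hst : s ≤ t) : ∫ ω, (W t ω - W s ω) ∂P = 0 := by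
  rw [(hW.gaussian_increments s t hst).integral_eq, integral_id_gaussianReal]

lemma IsBrownianMotion.integral_increment_mul_self [IsProbabilityMeasure P]
    (hW : IsBrownianMotion P W) {s t : unitInterval} (hst : s ≤ t) :
    ∫ ω, (W t ω - W s ω) * (W t ω - W s ω) ∂P = t - s := by
  have h := (hW.gaussian_increments s t hst).variance_eq
  rw [variance_id_gaussianReal, variance_of_integral_eq_zero
    (hW.gaussian_increments s t hst).aemeasurable (hW.integral_increment hst)] at h
  have h' : (s : ℝ) ≤ t := hst
  simp only [sq, Real.coe_toNNReal _ (sub_nonneg.2 h')] at h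
  exact h

/-- Split the later increment at `u`: the cross term vanishes because it is a product of independent
centred variables. -/
lemma IsBrownianMotion.covariance_of_le [IsProbabilityMeasure P] (hW : IsBrownianMotion P W)
    {u v : unitInterval} (huv : u ≤ v) :
    ∫ ω, (W u ω - W 0 ω) * (W v ω - W 0 ω) ∂P = u := by
  have h0 : ∀ t : unitInterval, 0 ≤ t := fun t => t.2.1
  have hind := hW.indep_increments.indepFun_sub_sub (h0 u) huv
  have he : ∀ ω, (W u ω - W 0 ω) * (W v ω - W 0 ω)
      = (W u ω - W 0 ω) * (W u ω - W 0 ω) + (W u ω - W 0 ω) * (W v ω - W u ω) := fun ω => by ring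
  simp only [he]
  have hi1 : Integrable (fun ω => (W u ω - W 0 ω) * (W u ω - W 0 ω)) P :=
    (hW.memLp_increment (h0 u)).integrable_mul (hW.memLp_increment (h0 u))
  have hi2 : Integrable (fun ω => (W u ω - W 0 ω) * (W v ω - W u ω)) P :=
    (hW.memLp_increment (h0 u)).integrable_mul (hW.memLp_increment huv)
  rw [integral_add hi1 hi2, hW.integral_increment_mul_self (h0 u)]
  have := hind.integral_mul_eq_mul_integral
    (hW.memLp_increment (h0 u)).aestronglyMeasurable (hW.memLp_increment huv).aestronglyMeasurable
  simp only [Pi.mul_apply, Pi.sub_apply] at this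
  rw [this, hW.integral_increment huv]
  simp

lemma IsBrownianMotion.covariance [IsProbabilityMeasure P] (hW : IsBrownianMotion P W)
    (u v : unitInterval) : ∫ ω, (W u ω - W 0 ω) * (W v ω - W 0 ω) ∂P = min (u : ℝ) v := by
  rcases le_total u v with h | h
  · rw [hW.covariance_of_le h, min_eq_left (show (u : ℝ) ≤ v from h)]
  · simp only [mul_comm (W u _ - W 0 _)]
    rw [hW.covariance_of_le h, min_eq_right (show (v : ℝ) ≤ u from h)]

lemma StepFunction.integral_eq {Ω' : Type*} (φ : StepFunction) (W : unitInterval → Ω' → ℝ)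
    (ω : Ω') :
    φ.integral W ω = ∑ i, φ.c i * ((W (φ.b i) ω - W 0 ω) - (W (φ.a i) ω - W 0 ω)) :=
  Finset.sum_congr rfl fun i _ => by ring

lemma IsBrownianMotion.memLp_integral (hW : IsBrownianMotion P W) (φ : StepFunction) :
    MemLp (φ.integral W) 2 P :=
  memLp_finsetSum _ fun i _ => (hW.memLp_increment (φ.a_le_b i)).const_mul _

/-- The Wiener isometry for step functions. -/
theorem IsBrownianMotion.eLpNorm_integral [IsProbabilityMeasure P] (hW : IsBrownianMotion P W)
    (φ : StepFunction) :
    eLpNorm (φ.integral W) 2 P = eLpNorm φ.toFun 2 (volume.restrict (Set.Icc (0 : ℝ) 1)) := by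
  refine eLpNorm_two_congr (hW.memLp_integral φ) φ.memLp_toFun ?_
  simp only [φ.integral_eq, φ.toFun_eq]
  -- Both sides are the same linear combination of increments of families with covariance min(u,v).
  -- The intervals of `φ` may therefore overlap.
  rw [integral_sum_increments (g := fun u ω => W u ω - W 0 ω)
      (fun u => hW.memLp_increment (show 0 ≤ u from u.2.1)) hW.covariance,
    integral_sum_increments memLp_indicator_Ioc integral_indicator_Ioc_mul]

/-- The difference of two step functions. -/
noncomputable def StepFunction.sub (φ ψ : StepFunction) : StepFunction where
  n := φ.n + ψ.n
  a := Fin.append φ.a ψ.a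
  b := Fin.append φ.b ψ.b
  a_le_b i := by
    refine Fin.addCases (fun i => ?_) (fun i => ?_) i
    · simpa using φ.a_le_b i
    · simpa using ψ.a_le_b i
  c := Fin.append φ.c fun i => -ψ.c i

lemma StepFunction.toFun_sub (φ ψ : StepFunction) (s : ℝ) :
    (φ.sub ψ).toFun s = φ.toFun s - ψ.toFun s := by
  refine (Fin.sum_univ_add (a := φ.n) (b := ψ.n) _).trans ?_
  simp [StepFunction.toFun, StepFunction.sub, sub_eq_add_neg]

lemma StepFunction.integral_sub {Ω' : Type*} (φ ψ : StepFunction) (W : unitInterval → Ω' → ℝ)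
    (ω : Ω') :
    (φ.sub ψ).integral W ω = φ.integral W ω - ψ.integral W ω := by
  refine (Fin.sum_univ_add (a := φ.n) (b := ψ.n) _).trans ?_
  simp only [StepFunction.integral, StepFunction.sub, Fin.append_left, Fin.append_right, neg_mul,
    Finset.sum_neg_distrib, ← sub_eq_add_neg]

/-- The restriction of a step function to the interval `(0, t]`. -/
noncomputable def StepFunction.upTo (φ : StepFunction) (t : unitInterval) : StepFunction where
  n := φ.n
  a i := min (φ.a i) t
  b i := min (φ.b i) t
  a_le_b i := min_le_min_right t (φ.a_le_b i)
  c := φ.c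

/-- Intervals lying beyond `t` collapse to the empty (t,t], which is why half-open intervals are
convenient. -/
lemma StepFunction.toFun_upTo (φ : StepFunction) (t : unitInterval) (s : ℝ) :
    (φ.upTo t).toFun s = (Set.Ioc (0 : ℝ) t).indicator φ.toFun s := by
  have hco : ∀ u v : unitInterval, ((min u v : unitInterval) : ℝ) = min (u : ℝ) v := fun u v => by
    rcases le_total u v with h | h
    · rw [min_eq_left h, min_eq_left (show (u : ℝ) ≤ v from h)]
    · rw [min_eq_right h, min_eq_right (show (v : ℝ) ≤ u from h)]
  by_cases hs : s ∈ Set.Ioc (0 : ℝ) t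
  · rw [Set.indicator_of_mem hs]
    refine Finset.sum_congr rfl fun i _ => ?_
    obtain ⟨hs1, hs2⟩ := hs
    simp only [upTo, hco, Set.indicator_apply, Set.mem_Ioc, le_inf_iff, inf_lt_iff]
    grind
  · rw [Set.indicator_of_notMem hs]
    refine Finset.sum_eq_zero fun i _ => ?_
    have h2 : (0 : ℝ) ≤ φ.a i := (φ.a i).2.1
    have h3 : (0 : ℝ) ≤ t := t.2.1
    simp only [upTo, hco, Set.indicator_apply, Set.mem_Ioc, inf_lt_iff, le_inf_iff] at hs ⊢
    grind

lemma StepFunction.integral_upTo_sub {Ω' : Type*} (φ ψ : StepFunction) (t : unitInterval)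
    (W : unitInterval → Ω' → ℝ) (ω : Ω') :
    ((φ.sub ψ).upTo t).integral W ω = (φ.upTo t).integral W ω - (ψ.upTo t).integral W ω := by
  refine (Fin.sum_univ_add (a := φ.n) (b := ψ.n) _).trans ?_
  simp only [StepFunction.integral, StepFunction.sub, upTo, Fin.append_left, Fin.append_right,
    neg_mul, Finset.sum_neg_distrib, ← sub_eq_add_neg]
  rfl

end Isometry


/-! ### Maximal inequality for elementary integrals -/

section Maximal

variable {Ω : Type*} [mΩ : MeasurableSpace Ω] {P : Measure Ω}

/-- A maximal inequality for sums of independent centered random variables. -/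
theorem maximal_ineq_sum [IsProbabilityMeasure P] {Y : ℕ → Ω → ℝ} (hY : ∀ i, Measurable (Y i))
    (hind : iIndepFun Y P) (hint : ∀ i, Integrable (Y i) P) (hmean : ∀ i, ∫ ω, Y i ω ∂P = 0)
    (η : NNReal) (n : ℕ) :
    η * P {ω | ∃ k ≤ n, (η : ℝ) ≤ |∑ i ∈ Finset.range k, Y i ω|}
      ≤ eLpNorm (fun ω => ∑ i ∈ Finset.range n, Y i ω) 2 P := by
  rcases eq_or_ne η 0 with rfl | hη
  · simp
  have hη' : (0 : ℝ) < η := by positivity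
  obtain _ | n := n
  · have : {ω : Ω | ∃ k ≤ 0, (η : ℝ) ≤ |∑ i ∈ Finset.range k, Y i ω|} = ∅ := by
      ext ω
      simpa using pos_iff_ne_zero.2 hη
    rw [this]
    simp
  have hYs : ∀ i, StronglyMeasurable (Y i) := fun i => (hY i).stronglyMeasurable
  set F := Filtration.natural Y hYs with hF
  -- The natural filtration at `n` knows Y 0, …, Y n, so the adapted sum has n + 1 terms. The
  -- omitted empty sum never reaches the positive level `η`.
  set S : ℕ → Ω → ℝ := fun n ω => ∑ i ∈ Finset.range (n + 1), Y i ω with hS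
  have hSi : ∀ n, Integrable (S n) P := fun n => integrable_finsetSum _ fun i _ => hint i
  have hM : Martingale S F P := by
    refine martingale_of_condExp_sub_eq_zero_nat (fun n => ?_) hSi fun n => ?_
    · refine Finset.stronglyMeasurable_fun_sum _ fun i hi => ?_
      exact (Filtration.stronglyAdapted_natural hYs i).mono
        (F.mono (Nat.lt_succ_iff.1 (Finset.mem_range.1 hi)))
    · have he : S (n + 1) - S n = Y (n + 1) := by
        ext ω
        simp [hS, Finset.sum_range_succ _ (n + 1)]
      rw [he]
      refine (iIndepFun.condExp_natural_ae_eq_of_lt hYs hind n.lt_succ_self).trans ?_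
      rw [hmean]
      rfl
  have hsub : Submartingale (S ⊔ -S) F P := hM.submartingale.sup hM.neg.submartingale
  have habs : ∀ k ω, (S ⊔ -S) k ω = |S k ω| := fun k ω => rfl
  have key := maximal_ineq hsub (fun k ω => by rw [habs]; exact abs_nonneg _) (ε := η) n
  have hset : {ω | ∃ k ≤ n + 1, (η : ℝ) ≤ |∑ i ∈ Finset.range k, Y i ω|}
      ⊆ {ω | (η : ℝ) ≤ (Finset.range (n + 1)).sup' Finset.nonempty_range_add_one
          fun k => (S ⊔ -S) k ω} := by
    rintro ω ⟨k, hk, h⟩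
    obtain _ | k := k
    · simp at h
      exact absurd h (not_le.2 hη')
    · exact le_trans h (Finset.le_sup' (fun k => (S ⊔ -S) k ω)
        (Finset.mem_range.2 (Nat.lt_of_succ_le hk)))
  calc η * P {ω | ∃ k ≤ n + 1, (η : ℝ) ≤ |∑ i ∈ Finset.range k, Y i ω|}
      ≤ _ := by gcongr
    _ ≤ _ := key
    _ ≤ ENNReal.ofReal (∫ ω, |S n ω| ∂P) := by
      refine ENNReal.ofReal_le_ofReal ?_
      exact setIntegral_le_integral (hSi n).abs (ae_of_all _ fun ω => abs_nonneg _)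
    _ = eLpNorm (S n) 1 P := by
      rw [eLpNorm_one_eq_lintegral_enorm, ofReal_integral_eq_lintegral_ofReal (hSi n).abs
        (ae_of_all _ fun ω => abs_nonneg _)]
      simp only [Real.enorm_eq_ofReal_abs]
    _ ≤ eLpNorm (S n) 2 P :=
      eLpNorm_le_eLpNorm_of_exponent_le (by norm_num) (hSi n).aestronglyMeasurable

/-- A monotone enumeration of a finite set of times. -/
lemma exists_grid (S : Finset unitInterval) (h0 : 0 ∈ S) :
    ∃ s : ℕ → unitInterval, Monotone s ∧ s 0 = 0 ∧ (∃ n, ∀ u ∈ S, ∃ k ≤ n, s k = u) ∧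
      ∀ u ∈ S, ∀ k, u ≤ s k ∨ s (k + 1) ≤ u := by
  have hcard : 0 < S.card := Finset.card_pos.2 ⟨0, h0⟩
  set e := S.orderEmbOfFin rfl with he
  -- The enumeration stays at the last point once the set is exhausted.
  let s : ℕ → unitInterval := fun k => e ⟨min k (S.card - 1), by omega⟩
  have hs : Monotone s := fun i j hij => e.monotone (Fin.mk_le_mk.2 (min_le_min_right _ hij))
  have hex : ∀ u ∈ S, ∃ k : Fin S.card, e k = u := fun u hu => by
    have : u ∈ Set.range e := by rw [he, Finset.range_orderEmbOfFin]; exact hu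
    exact this
  have hsk : ∀ k : Fin S.card, s k = e k := fun k => by
    have hk := k.2
    simp only [s]
    congr 1
    ext
    simp only
    omega
  refine ⟨s, hs, ?_, ⟨S.card, fun u hu => ?_⟩, fun u hu k => ?_⟩
  · obtain ⟨k, hk⟩ := hex 0 h0
    refine le_antisymm ?_ (s 0).2.1
    rw [← hk, ← hsk]
    exact hs (Nat.zero_le _)
  · obtain ⟨k, hk⟩ := hex u hu
    exact ⟨k, k.2.le, (hsk k).trans hk⟩
  · obtain ⟨j, hj⟩ := hex u hu
    rcases le_or_gt (j : ℕ) k with h | h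
    · left
      rw [← hj, ← hsk]
      exact hs h
    · right
      rw [← hj, ← hsk]
      exact hs h

variable {W : unitInterval → Ω → ℝ}

lemma StepFunction.integral_upTo_zero {Ω' : Type*} (φ : StepFunction)
    (W : unitInterval → Ω' → ℝ) (ω : Ω') : (φ.upTo 0).integral W ω = 0 := by
  refine Finset.sum_eq_zero fun i _ => ?_
  simp [upTo]

lemma StepFunction.integral_upTo_one {Ω' : Type*} (φ : StepFunction)
    (W : unitInterval → Ω' → ℝ) (ω : Ω') : (φ.upTo 1).integral W ω = φ.integral W ω := by
  have : ∀ u : unitInterval, min u 1 = u := fun u => min_eq_left u.2.2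
  simp only [StepFunction.integral, upTo, this]
  rfl

/-- Along a grid containing all jump times, the increments of the elementary integral are
multiples of the increments of `W`. -/
lemma StepFunction.integral_upTo_grid {Ω' : Type*} (φ : StepFunction)
    (W : unitInterval → Ω' → ℝ) {s : ℕ → unitInterval} (hs : Monotone s) (hs0 : s 0 = 0)
    (ha : ∀ i k, φ.a i ≤ s k ∨ s (k + 1) ≤ φ.a i) (hb : ∀ i k, φ.b i ≤ s k ∨ s (k + 1) ≤ φ.b i) :
    ∃ d : ℕ → ℝ, ∀ n ω, (φ.upTo (s n)).integral W ω
      = ∑ k ∈ Finset.range n, d k * (W (s (k + 1)) ω - W (s k) ω) := by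
  have hpt : ∀ u : unitInterval, ∀ k, (u ≤ s k ∨ s (k + 1) ≤ u) → ∀ ω,
      W (min u (s (k + 1))) ω - W (min u (s k)) ω
        = (if u ≤ s k then 0 else 1) * (W (s (k + 1)) ω - W (s k) ω) := by
    intro u k h ω
    have hle := hs k.le_succ
    split_ifs with h'
    · rw [min_eq_left h', min_eq_left (h'.trans hle)]
      ring
    · have h2 := h.resolve_left h'
      rw [min_eq_right h2, min_eq_right (hle.trans h2)]
      ring
  -- This is the constant value of `φ` on (s k, s (k+1)]: the term `c i` counts exactly when a i ≤ s
  -- k < b i.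
  refine ⟨fun k => ∑ i, φ.c i * ((if φ.b i ≤ s k then 0 else 1) - if φ.a i ≤ s k then 0 else 1),
    fun n ω => ?_⟩
  induction n with
  | zero => simp [hs0, φ.integral_upTo_zero]
  | succ n ih =>
    rw [Finset.sum_range_succ, ← ih, Finset.sum_mul, ← sub_eq_iff_eq_add']
    simp only [StepFunction.integral]
    refine (Finset.sum_sub_distrib _ _).symm.trans (Finset.sum_congr rfl fun i _ => ?_)
    have e1 := hpt _ n (ha i n) ω
    have e2 := hpt _ n (hb i n) ω
    simp only [upTo]
    linear_combination φ.c i * e2 - φ.c i * e1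

/-- The maximal inequality for elementary integrals along a finite set of times. -/
theorem IsBrownianMotion.maximal_finset [IsProbabilityMeasure P] (hW : IsBrownianMotion P W)
    (φ : StepFunction) (T : Finset unitInterval) (η : NNReal) :
    η * P {ω | ∃ t ∈ T, (η : ℝ) ≤ |(φ.upTo t).integral W ω|}
      ≤ eLpNorm φ.toFun 2 (volume.restrict (Set.Icc (0 : ℝ) 1)) := by
  classical
  -- Along a grid containing `T`, all jump times and both end points, the elementary integrals are
  -- partial sums of independent centred variables, the last being the full integral.
  obtain ⟨s, hs, hs0, ⟨n, hn⟩, hS⟩ := exists_grid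
    (T ∪ Finset.univ.image φ.a ∪ Finset.univ.image φ.b ∪ {0, 1}) (by simp)
  obtain ⟨d, hd⟩ := φ.integral_upTo_grid W hs hs0 (fun i => hS _ (by simp))
    (fun i => hS _ (by simp))
  have hs1 : s n = 1 := by
    obtain ⟨k, hk, hk1⟩ := hn 1 (by simp)
    exact le_antisymm (s n).2.2 (hk1 ▸ hs hk)
  have key := maximal_ineq_sum (P := P) (Y := fun k ω => d k * (W (s (k + 1)) ω - W (s k) ω))
    (fun k => ((hW.measurable _).sub (hW.measurable _)).const_mul _)
    ((hW.indep_increments.nat hs).comp (fun k x => d k * x) fun k => measurable_const_mul _)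
    (fun k => ((hW.memLp_increment (hs k.le_succ)).integrable (by norm_num)).const_mul _)
    (fun k => by rw [integral_const_mul, hW.integral_increment (hs k.le_succ), mul_zero]) η n
  simp only [← hd, hs1, φ.integral_upTo_one] at key
  rw [← hW.eLpNorm_integral φ]
  refine le_trans ?_ key
  refine mul_le_mul_right (measure_mono ?_) _
  rintro ω ⟨t, ht, h⟩
  obtain ⟨k, hk, rfl⟩ := hn t (by simp [ht])
  exact ⟨k, hk, h⟩

lemma StepFunction.continuous_integral_upTo {Ω' : Type*} (φ : StepFunction)
    {W : unitInterval → Ω' → ℝ} {ω : Ω'} (hω : Continuous fun t => W t ω) :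
    Continuous fun t => (φ.upTo t).integral W ω := by
  change Continuous fun t => ∑ i : Fin φ.n,
    φ.c i * (W (min (φ.b i) t) ω - W (min (φ.a i) t) ω)
  refine continuous_finsetSum Finset.univ fun i _ => ?_
  refine Continuous.mul continuous_const (Continuous.sub ?_ ?_)
  · exact hω.comp (continuous_const.min continuous_id)
  · exact hω.comp (continuous_const.min continuous_id)

/-- The maximal inequality for elementary integrals. -/
theorem IsBrownianMotion.maximal [IsProbabilityMeasure P] (hW : IsBrownianMotion P W)
    (φ : StepFunction) (η : NNReal) :
    η * P {ω | ∃ t, (η : ℝ) < |(φ.upTo t).integral W ω|}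
      ≤ eLpNorm φ.toFun 2 (volume.restrict (Set.Icc (0 : ℝ) 1)) := by
  let u := TopologicalSpace.denseSeq unitInterval
  have hu : DenseRange u := TopologicalSpace.denseRange_denseSeq _
  let E : ℕ → Set Ω := fun r =>
    {ω | ∃ t ∈ (Finset.range r).image u, (η : ℝ) ≤ |(φ.upTo t).integral W ω|}
  have hE : Monotone E := by
    rintro r r' h ω ⟨t, ht, h'⟩
    exact ⟨t, Finset.image_subset_image (Finset.range_mono h) ht, h'⟩
  have hsup : P {ω | ∃ t, (η : ℝ) < |(φ.upTo t).integral W ω|} ≤ P (⋃ r, E r) := by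
    refine measure_mono_ae ?_
    filter_upwards [hW.continuous_paths] with ω hω h
    obtain ⟨t, ht⟩ := h
    -- For a continuous path the strict inequality holds on an open set of times, which meets the
    -- dense sequence.
    obtain ⟨_, h', i, rfl⟩ := (hu.inter_open_nonempty _
      (isOpen_lt continuous_const (φ.continuous_integral_upTo hω).abs) ⟨t, ht⟩)
    exact Set.mem_iUnion.2 ⟨i + 1, u i,
      Finset.mem_image.2 ⟨i, Finset.mem_range.2 i.lt_succ_self, rfl⟩, le_of_lt h'⟩
  refine (mul_le_mul_right hsup _).trans ?_
  rw [hE.measure_iUnion, ENNReal.mul_iSup]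
  exact iSup_le fun r => hW.maximal_finset φ _ η

end Maximal


/-! ### The Wiener integral process: existence, uniqueness, measurability -/

section WienerIntegral

/-- The left-point step function approximation of `g` on the uniform grid with mesh `1 / n`. -/
noncomputable def StepFunction.leftPoint (g : ℝ → ℝ) (n : ℕ) : StepFunction where
  n := n
  a i := ⟨(i : ℝ) / n, by positivity, by
    have := i.2
    have h : ((i : ℕ) : ℝ) ≤ n := by exact_mod_cast this.le
    exact div_le_one_of_le₀ h (by positivity)⟩
  b i := ⟨((i : ℝ) + 1) / n, by positivity, by
    have := i.2
    have h : ((i : ℕ) : ℝ) + 1 ≤ n := by exact_mod_cast this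
    exact div_le_one_of_le₀ h (by positivity)⟩
  a_le_b i := Subtype.mk_le_mk.2 (by gcongr; linarith)
  c i := g ((i : ℝ) / n)

lemma StepFunction.leftPoint_apply (g : ℝ → ℝ) {n : ℕ} (hn : 0 < n) {s : ℝ} (h0 : 0 < s)
    (h1 : s ≤ 1) : ∃ r ∈ Set.Icc (0 : ℝ) 1, |r - s| ≤ 1 / n ∧ (leftPoint g n).toFun s = g r := by
  have hn' : (0 : ℝ) < n := by exact_mod_cast hn
  -- The cells are open on the left and closed on the right, so the cell containing `s` has index
  -- ⌈sn⌉ - 1.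
  obtain ⟨k, hk⟩ : ∃ k, ⌈s * n⌉₊ = k + 1 :=
    Nat.exists_eq_succ_of_ne_zero (Nat.ceil_pos.2 (mul_pos h0 hn')).ne'
  have hmem : ∀ i : ℕ, s ∈ Set.Ioc ((i : ℝ) / n) (((i : ℝ) + 1) / n) ↔ i = k := by
    intro i
    rw [Set.mem_Ioc, div_lt_iff₀ hn', le_div_iff₀ hn']
    have h := Nat.ceil_eq_iff (a := s * n) (n := i + 1) (by omega)
    push_cast at h
    rw [← h, hk]
    omega
  have hkn : k < n := by
    have : ⌈s * n⌉₊ ≤ n := Nat.ceil_le.2 (by nlinarith)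
    omega
  have hks := (hmem k).2 rfl
  refine ⟨(k : ℝ) / n, ⟨by positivity, hks.1.le.trans h1⟩, ?_, ?_⟩
  · rw [abs_sub_comm, abs_of_nonneg (by linarith [hks.1])]
    have := hks.2
    rw [add_div] at this
    linarith
  · change ∑ i : Fin n, g ((i : ℝ) / n) *
      (Set.Ioc ((i : ℝ) / n) (((i : ℝ) + 1) / n)).indicator (fun _ => (1 : ℝ)) s = _
    rw [Finset.sum_eq_single ⟨k, hkn⟩]
    · simp only
      rw [Set.indicator_of_mem hks, mul_one]
    · intro i _ hi
      rw [Set.indicator_of_notMem, mul_zero]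
      rw [hmem]
      exact fun h => hi (Fin.ext h)
    · simp

/-- Step functions are dense in `L²([0,1])`. -/
lemma exists_stepFunction_eLpNorm_sub_le {δ : ℝ → ℝ}
    (hδ : MemLp δ 2 (volume.restrict (Set.Icc (0 : ℝ) 1))) {ε : ENNReal} (hε : ε ≠ 0) :
    ∃ φ : StepFunction,
      eLpNorm (fun s => φ.toFun s - δ s) 2 (volume.restrict (Set.Icc (0 : ℝ) 1)) ≤ ε := by
  have hε2 : ε / 2 ≠ 0 := by simpa using hε
  -- Approximate by a continuous function, then use its uniform continuity on [0,1]; a uniform error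
  -- bounds the L² error on an interval of length one.
  obtain ⟨g, hg, hgm⟩ := hδ.exists_boundedContinuous_eLpNorm_sub_le (by simp) hε2
  obtain ⟨η, hη0, hη⟩ : ∃ η : ℝ, 0 < η ∧ ENNReal.ofReal η ≤ ε / 2 := by
    obtain ⟨η, h0, h⟩ := ENNReal.lt_iff_exists_nnreal_btwn.1 (pos_iff_ne_zero.2 hε2)
    exact ⟨η, by exact_mod_cast h0, by simpa using h.le⟩
  have huc := isCompact_Icc.uniformContinuousOn_of_continuous
    (g.continuous.continuousOn (s := Set.Icc (0 : ℝ) 1))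
  obtain ⟨r, hr, hrr⟩ := Metric.uniformContinuousOn_iff.1 huc η hη0
  obtain ⟨n, hn⟩ := exists_nat_one_div_lt hr
  refine ⟨StepFunction.leftPoint g (n + 1), ?_⟩
  have h1 : eLpNorm (fun s => (StepFunction.leftPoint g (n + 1)).toFun s - g s) 2
      (volume.restrict (Set.Icc (0 : ℝ) 1)) ≤ ε / 2 := by
    refine (eLpNorm_le_of_ae_bound (C := η) ?_).trans ?_
    · filter_upwards [ae_restrict_mem measurableSet_Icc,
        Measure.ae_ne (volume.restrict (Set.Icc (0 : ℝ) 1)) 0] with s hs hs0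
      obtain ⟨q, hq, hqs, he⟩ := StepFunction.leftPoint_apply g n.succ_pos
        (lt_of_le_of_ne hs.1 (Ne.symm hs0)) hs.2
      rw [he]
      refine (hrr q hq s hs ?_).le
      rw [Real.dist_eq]
      refine hqs.trans_lt ?_
      push_cast
      exact hn
    · simpa using hη
  calc eLpNorm (fun s => (StepFunction.leftPoint g (n + 1)).toFun s - δ s) 2
        (volume.restrict (Set.Icc (0 : ℝ) 1))
      = eLpNorm ((fun s => (StepFunction.leftPoint g (n + 1)).toFun s - g s) - (δ - ⇑g)) 2
        (volume.restrict (Set.Icc (0 : ℝ) 1)) := by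
        congr 1
        ext s
        simp
    _ ≤ _ := eLpNorm_sub_le
        ((StepFunction.memLp_toFun _).aestronglyMeasurable.sub hgm.aestronglyMeasurable)
        (hδ.aestronglyMeasurable.sub hgm.aestronglyMeasurable) (by norm_num)
    _ ≤ ε / 2 + ε / 2 := add_le_add h1 hg
    _ = ε := ENNReal.add_halves ε

lemma eLpNorm_toFun_sub_le {g : ℝ → ℝ}
    (hg : AEStronglyMeasurable g (volume.restrict (Set.Icc (0 : ℝ) 1))) (φ ψ : StepFunction) :
    eLpNorm (φ.sub ψ).toFun 2 (volume.restrict (Set.Icc (0 : ℝ) 1)) ≤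
      eLpNorm (fun s => φ.toFun s - g s) 2 (volume.restrict (Set.Icc (0 : ℝ) 1)) +
      eLpNorm (fun s => ψ.toFun s - g s) 2 (volume.restrict (Set.Icc (0 : ℝ) 1)) := by
  refine le_of_eq_of_le ?_ (eLpNorm_sub_le (φ.memLp_toFun.aestronglyMeasurable.sub hg)
    (ψ.memLp_toFun.aestronglyMeasurable.sub hg) (by norm_num))
  congr 1
  ext s
  simp [StepFunction.toFun_sub]

variable {Ω : Type*} [mΩ : MeasurableSpace Ω] {P : Measure Ω} {W : unitInterval → Ω → ℝ}

/-- The Wiener integral is unique almost surely. -/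
theorem IsWienerIntegral.ae_eq [IsProbabilityMeasure P] (hW : IsBrownianMotion P W) {g : ℝ → ℝ}
    (hg : AEStronglyMeasurable g (volume.restrict (Set.Icc (0 : ℝ) 1))) {Z Z' : Ω → ℝ}
    (hZ : IsWienerIntegral P W g Z) (hZ' : IsWienerIntegral P W g Z') : Z =ᵐ[P] Z' := by
  obtain ⟨hm, φ, h1, h2⟩ := hZ
  obtain ⟨hm', φ', h1', h2'⟩ := hZ'
  have hle : ∀ n, eLpNorm (Z - Z') 2 P ≤
      (eLpNorm (fun s => (φ n).toFun s - g s) 2 (volume.restrict (Set.Icc (0 : ℝ) 1)) +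
        eLpNorm (fun s => (φ' n).toFun s - g s) 2 (volume.restrict (Set.Icc (0 : ℝ) 1))) +
      (eLpNorm (fun ω => (φ' n).integral W ω - Z' ω) 2 P +
        eLpNorm (fun ω => (φ n).integral W ω - Z ω) 2 P) := by
    intro n
    have hi := (hW.memLp_integral (φ n)).aestronglyMeasurable
    have hi' := (hW.memLp_integral (φ' n)).aestronglyMeasurable
    -- The isometry controls the first summand by the distance of the step functions; the rest are
    -- the two approximation errors.
    have he : Z - Z' = ((φ n).sub (φ' n)).integral W +
        ((fun ω => (φ' n).integral W ω - Z' ω) - fun ω => (φ n).integral W ω - Z ω) := by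
      ext ω
      simp only [StepFunction.integral_sub, Pi.add_apply, Pi.sub_apply]
      ring
    rw [he]
    refine (eLpNorm_add_le (hW.memLp_integral _).aestronglyMeasurable
      ((hi'.sub hm'.aestronglyMeasurable).sub (hi.sub hm.aestronglyMeasurable))
      (by norm_num)).trans (add_le_add ?_ ?_)
    · rw [hW.eLpNorm_integral]
      exact eLpNorm_toFun_sub_le hg _ _
    · exact eLpNorm_sub_le (hi'.sub hm'.aestronglyMeasurable) (hi.sub hm.aestronglyMeasurable)
        (by norm_num)
  have hlim := (h1.add h1').add (h2'.add h2)
  simp only [add_zero] at hlim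
  have h0 : eLpNorm (Z - Z') 2 P = 0 := le_antisymm (ge_of_tendsto' hlim hle) zero_le
  have := (eLpNorm_eq_zero_iff (hm.aestronglyMeasurable.sub hm'.aestronglyMeasurable)
    (by norm_num)).1 h0
  filter_upwards [this] with ω hω
  exact sub_eq_zero.1 hω

lemma aestronglyMeasurable_indicator_Icc {δ : ℝ → ℝ}
    (hδ : MemLp δ 2 (volume.restrict (Set.Icc (0 : ℝ) 1))) (t : ℝ) :
    AEStronglyMeasurable ((Set.Icc 0 t).indicator δ) (volume.restrict (Set.Icc (0 : ℝ) 1)) :=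
  hδ.aestronglyMeasurable.indicator measurableSet_Icc

/-- Countably many times determine a continuous path. This turns almost sure equality at each time
into equality of paths, and makes evaluation along `u` injective. -/
lemma exists_dense_seq_eqOn : ∃ u : ℕ → unitInterval, ∀ x y : ℝ → ℝ,
    ContinuousOn x (Set.Icc 0 1) → ContinuousOn y (Set.Icc 0 1) → (∀ i, x (u i) = y (u i)) →
    ∀ t ∈ Set.Icc (0 : ℝ) 1, x t = y t := by
  refine ⟨TopologicalSpace.denseSeq unitInterval, fun x y hx hy h t ht => ?_⟩
  have := (TopologicalSpace.denseRange_denseSeq unitInterval).equalizer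
    (continuousOn_iff_continuous_domRestrict.1 hx) (continuousOn_iff_continuous_domRestrict.1 hy)
    (funext h)
  exact congrFun this ⟨t, ht⟩

/-- The continuous stochastic integral process is unique up to indistinguishability. -/
theorem IsWienerIntegralProcess.indistinguishable [IsProbabilityMeasure P]
    (hW : IsBrownianMotion P W) {δ : ℝ → ℝ}
    (hδ : MemLp δ 2 (volume.restrict (Set.Icc (0 : ℝ) 1))) {M M' : ℝ → Ω → ℝ}
    (hM : IsWienerIntegralProcess P W δ M) (hM' : IsWienerIntegralProcess P W δ M') :
    ∀ᵐ ω ∂P, ∀ t ∈ Set.Icc (0 : ℝ) 1, M t ω = M' t ω := by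
  obtain ⟨u, hu⟩ := exists_dense_seq_eqOn
  have hae : ∀ᵐ ω ∂P, ∀ i, M (u i) ω = M' (u i) ω := ae_all_iff.2 fun i =>
    (hM.integral _ (u i).2).ae_eq hW (aestronglyMeasurable_indicator_Icc hδ _)
      (hM'.integral _ (u i).2)
  filter_upwards [hae, hM.continuous_paths, hM'.continuous_paths] with ω h h1 h2
  exact hu _ _ h1 h2 h

/-- The stochastic integral process starts at zero. -/
lemma IsWienerIntegralProcess.start [IsProbabilityMeasure P]
    (hW : IsBrownianMotion P W) {δ : ℝ → ℝ}
    (hδ : MemLp δ 2 (volume.restrict (Set.Icc (0 : ℝ) 1))) {M : ℝ → Ω → ℝ}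
    (hM : IsWienerIntegralProcess P W δ M) : ∀ᵐ ω ∂P, M 0 ω = 0 := by
  let φ : StepFunction := ⟨0, Fin.elim0, Fin.elim0, fun i => i.elim0, Fin.elim0⟩
  have h1 : eLpNorm (fun s => φ.toFun s - (Set.Icc 0 (0 : ℝ)).indicator δ s) 2
      (volume.restrict (Set.Icc (0 : ℝ) 1)) = 0 := by
    rw [eLpNorm_congr_ae (g := 0), eLpNorm_zero]
    filter_upwards [Measure.ae_ne (volume.restrict (Set.Icc (0 : ℝ) 1)) 0] with s hs
    have : s ∉ Set.Icc (0 : ℝ) 0 := by simpa using hs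
    rw [Set.indicator_of_notMem this]
    simp [StepFunction.toFun, φ]
  have h2 : eLpNorm (fun ω => φ.integral W ω - 0) 2 P = 0 := by
    rw [eLpNorm_congr_ae (g := 0), eLpNorm_zero]
    exact ae_of_all _ fun ω => by simp [StepFunction.integral, φ]
  exact (hM.integral 0 ⟨le_rfl, zero_le_one⟩).ae_eq hW (aestronglyMeasurable_indicator_Icc hδ _)
    (Z' := fun _ => 0) ⟨MemLp.zero, fun _ => φ, by simp only [h1]; exact tendsto_const_nhds,
      by simp only [h2]; exact tendsto_const_nhds⟩

lemma eLpNorm_toFun_upTo_le (φ : StepFunction) (t : unitInterval) :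
    eLpNorm (φ.upTo t).toFun 2 (volume.restrict (Set.Icc (0 : ℝ) 1)) ≤
      eLpNorm φ.toFun 2 (volume.restrict (Set.Icc (0 : ℝ) 1)) := by
  have : (φ.upTo t).toFun = (Set.Ioc (0 : ℝ) t).indicator φ.toFun := funext (φ.toFun_upTo t)
  rw [this]
  exact eLpNorm_indicator_le _

/-- Up to the null point 0, truncation at `t` restricts both functions to the same set. One sequence
approximating `δ` thus serves every `t`. -/
lemma eLpNorm_toFun_upTo_sub_le (φ : StepFunction) (δ : ℝ → ℝ) (t : unitInterval) :
    eLpNorm (fun s => (φ.upTo t).toFun s - (Set.Icc 0 (t : ℝ)).indicator δ s) 2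
        (volume.restrict (Set.Icc (0 : ℝ) 1)) ≤
      eLpNorm (fun s => φ.toFun s - δ s) 2 (volume.restrict (Set.Icc (0 : ℝ) 1)) := by
  refine le_of_eq_of_le (eLpNorm_congr_ae ?_) (eLpNorm_indicator_le (s := Set.Icc 0 (t : ℝ)) _)
  filter_upwards [Measure.ae_ne (volume.restrict (Set.Icc (0 : ℝ) 1)) 0] with s hs
  rw [StepFunction.toFun_upTo]
  simp only [Set.indicator_apply, Set.mem_Ioc, Set.mem_Icc]
  grind

/-- Elementary integrals of rapidly converging step functions converge uniformly in time. -/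
lemma IsBrownianMotion.ae_exists_limit [IsProbabilityMeasure P] (hW : IsBrownianMotion P W)
    {φ : ℕ → StepFunction} (hφ : ∀ j, eLpNorm ((φ j).sub (φ (j + 1))).toFun 2
      (volume.restrict (Set.Icc (0 : ℝ) 1)) ≤ 2 * (4⁻¹ : ENNReal) ^ j) :
    ∀ᵐ ω ∂P, ∃ f : C(unitInterval, ℝ), ∀ t,
      Tendsto (fun j => ((φ j).upTo t).integral W ω) atTop (𝓝 (f t)) := by
  -- With level 2⁻ʲ and norm at most 2·4⁻ʲ, the maximal inequality gives P(E j) ≤ 2·2⁻ʲ. By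
  -- Borel–Cantelli, successive integrals eventually differ by at most 2⁻ʲ uniformly in time.
  let E : ℕ → Set Ω := fun j =>
    {ω | ∃ t, (((2⁻¹ : NNReal) ^ j : NNReal) : ℝ) < |(((φ j).sub (φ (j + 1))).upTo t).integral W ω|}
  have hE : ∀ j, P (E j) ≤ 2 * (2⁻¹ : ENNReal) ^ j := by
    intro j
    have h := (hW.maximal ((φ j).sub (φ (j + 1))) ((2⁻¹ : NNReal) ^ j)).trans (hφ j)
    have hc : (((2⁻¹ : NNReal) ^ j : NNReal) : ENNReal) = (2⁻¹ : ENNReal) ^ j := by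
      rw [ENNReal.coe_pow, ENNReal.coe_inv two_ne_zero, ENNReal.coe_ofNat]
    have h4 : (4⁻¹ : ENNReal) = 2⁻¹ * 2⁻¹ := by
      rw [← ENNReal.mul_inv (by simp) (by simp)]
      norm_num
    rw [hc, h4, mul_pow, mul_left_comm] at h
    have hne : (2⁻¹ : ENNReal) ^ j ≠ 0 := pow_ne_zero _ (by simp)
    have hnt : (2⁻¹ : ENNReal) ^ j ≠ ⊤ := ENNReal.pow_ne_top (by simp)
    exact (ENNReal.mul_le_mul_iff_right hne hnt).1 h
  have hsum : ∑' j, P (E j) ≠ ⊤ := by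
    refine ne_top_of_le_ne_top ?_ (ENNReal.tsum_le_tsum hE)
    rw [ENNReal.tsum_mul_left, ENNReal.tsum_geometric, ENNReal.one_sub_inv_two, inv_inv]
    exact ENNReal.mul_ne_top (by simp) (by simp)
  filter_upwards [ae_eventually_notMem hsum, hW.continuous_paths] with ω hω hc
  obtain ⟨J, hJ⟩ := eventually_atTop.1 hω
  let F : ℕ → C(unitInterval, ℝ) := fun j =>
    ⟨fun t => ((φ j).upTo t).integral W ω, (φ j).continuous_integral_upTo hc⟩
  have hdist : ∀ j, dist (F (j + J)) (F (j + 1 + J)) ≤ (2⁻¹ : ℝ) ^ J * (2⁻¹ : ℝ) ^ j := by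
    intro j
    refine (ContinuousMap.dist_le (by positivity)).2 fun t => ?_
    have := hJ (j + J) (Nat.le_add_left _ _)
    simp only [E, Set.mem_ofPred_eq, not_exists, not_lt] at this
    have h := this t
    rw [StepFunction.integral_upTo_sub] at h
    rw [Real.dist_eq, ← pow_add, add_comm J j, add_right_comm]
    simpa [F] using h
  have hcau : CauchySeq fun j => F (j + J) :=
    cauchySeq_of_le_geometric 2⁻¹ ((2⁻¹ : ℝ) ^ J) (by norm_num) hdist
  obtain ⟨f, hf⟩ := cauchySeq_tendsto_of_complete hcau
  refine ⟨f, fun t => ?_⟩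
  have h1 := (tendsto_add_atTop_iff_nat (f := F) J).1 hf
  exact ((continuous_eval_const t).tendsto f).comp h1

/-- Existence of the continuous stochastic integral process. -/
theorem IsBrownianMotion.exists_isWienerIntegralProcess [IsProbabilityMeasure P]
    (hW : IsBrownianMotion P W) {δ : ℝ → ℝ}
    (hδ : MemLp δ 2 (volume.restrict (Set.Icc (0 : ℝ) 1))) :
    ∃ M, IsWienerIntegralProcess P W δ M := by
  have hex : ∀ j : ℕ, ∃ φ : StepFunction, eLpNorm (fun s => φ.toFun s - δ s) 2
      (volume.restrict (Set.Icc (0 : ℝ) 1)) ≤ (4⁻¹ : ENNReal) ^ j := fun j =>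
    exists_stepFunction_eLpNorm_sub_le hδ (pow_ne_zero _ (by simp))
  choose φ hφ using hex
  have hanti : ∀ {i j : ℕ}, i ≤ j → (4⁻¹ : ENNReal) ^ j ≤ 4⁻¹ ^ i := fun h =>
    pow_le_pow_right_of_le_one' (ENNReal.inv_le_one.2 (by norm_num)) h
  have hsub : ∀ {i j : ℕ}, i ≤ j → eLpNorm ((φ i).sub (φ j)).toFun 2
      (volume.restrict (Set.Icc (0 : ℝ) 1)) ≤ 2 * (4⁻¹ : ENNReal) ^ i := fun {i j} h => by
    refine (eLpNorm_toFun_sub_le hδ.aestronglyMeasurable _ _).trans ?_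
    rw [two_mul]
    exact add_le_add (hφ i) ((hφ j).trans (hanti h))
  have hlim := hW.ae_exists_limit (φ := φ) fun j => hsub j.le_succ
  classical
  let G : Ω → C(unitInterval, ℝ) := fun ω =>
    if h : ∃ f : C(unitInterval, ℝ), ∀ t,
      Tendsto (fun j => ((φ j).upTo t).integral W ω) atTop (𝓝 (f t)) then h.choose else 0
  have hG : ∀ᵐ ω ∂P, ∀ t, Tendsto (fun j => ((φ j).upTo t).integral W ω) atTop (𝓝 (G ω t)) := by
    filter_upwards [hlim] with ω h
    simp only [G, dif_pos h]
    exact h.choose_spec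
  have hpow : Tendsto (fun j : ℕ => (4⁻¹ : ENNReal) ^ j) atTop (𝓝 0) :=
    ENNReal.tendsto_pow_atTop_nhds_zero_of_lt_one (ENNReal.inv_lt_one.2 (by norm_num))
  refine ⟨fun t ω => pathExtend (G ω) t, ⟨fun t ht => ?_,
    ae_of_all _ fun ω => (continuous_pathExtend _).continuousOn⟩⟩
  set τ : unitInterval := ⟨t, ht⟩ with hτ
  have hpe : (fun ω => pathExtend (G ω) t) = fun ω => G ω τ :=
    funext fun ω => pathExtend_apply _ ht
  rw [hpe]
  have hGt : ∀ᵐ ω ∂P, Tendsto (fun j => ((φ j).upTo τ).integral W ω) atTop (𝓝 (G ω τ)) := by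
    filter_upwards [hG] with ω h using h τ
  have hmeas : ∀ j, AEStronglyMeasurable (((φ j).upTo τ).integral W) P := fun j =>
    (hW.memLp_integral _).aestronglyMeasurable
  have hGm : AEStronglyMeasurable (fun ω => G ω τ) P :=
    aestronglyMeasurable_of_tendsto_ae atTop hmeas hGt
  have hbound : ∀ j, eLpNorm (fun ω => ((φ j).upTo τ).integral W ω - G ω τ) 2 P
      ≤ 2 * (4⁻¹ : ENNReal) ^ j := by
    intro j
    -- Fatou in `k` upgrades the almost sure limit to an L² rate, which identifies it as the Wiener
    -- integral.
    refine (Lp.eLpNorm_lim_le_liminf_eLpNorm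
      (f := fun k ω => ((φ j).upTo τ).integral W ω - ((φ k).upTo τ).integral W ω)
      (fun k => (hmeas j).sub (hmeas k)) _ ?_).trans ?_
    · filter_upwards [hGt] with ω h using tendsto_const_nhds.sub h
    · refine (liminf_le_limsup).trans (limsup_le_of_le (by isBoundedDefault) ?_)
      filter_upwards [eventually_ge_atTop j] with k hk
      have he : (fun ω => ((φ j).upTo τ).integral W ω - ((φ k).upTo τ).integral W ω)
          = (((φ j).sub (φ k)).upTo τ).integral W :=
        funext fun ω => (StepFunction.integral_upTo_sub _ _ _ _ _).symm
      rw [he, hW.eLpNorm_integral]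
      exact (eLpNorm_toFun_upTo_le _ _).trans (hsub hk)
  have h2pow : Tendsto (fun j : ℕ => 2 * (4⁻¹ : ENNReal) ^ j) atTop (𝓝 0) := by
    simpa using ENNReal.Tendsto.const_mul hpow (Or.inr (by simp : (2 : ENNReal) ≠ ⊤))
  refine ⟨?_, fun j => (φ j).upTo τ, ?_, ?_⟩
  · have h0 : MemLp (fun ω => ((φ 0).upTo τ).integral W ω - G ω τ) 2 P :=
      ⟨(hmeas 0).sub hGm, (hbound 0).trans_lt (by simp)⟩
    have := (hW.memLp_integral ((φ 0).upTo τ)).sub h0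
    refine this.congr_norm hGm (ae_of_all _ fun ω => ?_)
    simp
  · exact tendsto_of_tendsto_of_tendsto_of_le_of_le tendsto_const_nhds hpow (fun _ => zero_le)
      fun j => (eLpNorm_toFun_upTo_sub_le (φ j) δ τ).trans (hφ j)
  · exact tendsto_of_tendsto_of_tendsto_of_le_of_le tendsto_const_nhds h2pow (fun _ => zero_le)
      hbound

/-- Wiener integrals are measurable with respect to the completion of the σ-algebra generated by
the Brownian motion. -/
lemma IsWienerIntegral.aestronglyMeasurable {g : ℝ → ℝ} {Z : Ω → ℝ}
    (hW : IsBrownianMotion P W) (hZ : IsWienerIntegral P W g Z) :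
    AEStronglyMeasurable[⨆ s : unitInterval, MeasurableSpace.comap (W s) inferInstance] Z P := by
  obtain ⟨hm, φ, -, h2⟩ := hZ
  have hφ : ∀ n, StronglyMeasurable[⨆ s : unitInterval,
      MeasurableSpace.comap (W s) inferInstance] ((φ n).integral W) := by
    intro n
    have hWm : ∀ s, StronglyMeasurable[⨆ s : unitInterval,
        MeasurableSpace.comap (W s) inferInstance] (W s) := fun s =>
      (Measurable.mono (comap_measurable (W s))
        (le_iSup (fun s => MeasurableSpace.comap (W s) _) s) le_rfl).stronglyMeasurable
    exact Finset.stronglyMeasurable_fun_sum _ fun i _ =>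
      ((hWm _).sub (hWm _)).const_mul _
  -- L² convergence gives almost sure convergence along a subsequence; its pointwise `limUnder` is a
  -- version measurable with respect to `W`.
  obtain ⟨ns, -, hns⟩ := (tendstoInMeasure_of_tendsto_eLpNorm (by norm_num)
    (fun n => (hW.memLp_integral (φ n)).aestronglyMeasurable) hm.aestronglyMeasurable
    h2).exists_seq_tendsto_ae
  refine ⟨fun ω => limUnder atTop fun i => (φ (ns i)).integral W ω,
    @StronglyMeasurable.limUnder _ _ _ (⨆ s, MeasurableSpace.comap (W s) inferInstance) _ _ _ _ _ _
      _ fun i => hφ (ns i), ?_⟩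
  filter_upwards [hns] with ω h
  exact h.limUnder_eq.symm

/-- The stochastic integral process as a random element of `C([0,1])` that is measurable with
respect to the Brownian motion. -/
theorem IsWienerIntegralProcess.exists_path (hW : IsBrownianMotion P W) {δ : ℝ → ℝ}
    {M : ℝ → Ω → ℝ} (hM : IsWienerIntegralProcess P W δ M) :
    ∃ G : Ω → C(unitInterval, ℝ),
      (∀ F : C(unitInterval, ℝ) → ℝ, Continuous F →
        StronglyMeasurable[⨆ s : unitInterval, MeasurableSpace.comap (W s) inferInstance]
          fun ω => F (G ω)) ∧
      ∀ᵐ ω ∂P, ∀ t ∈ Set.Icc (0 : ℝ) 1, pathExtend (G ω) t = M t ω := by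
  obtain ⟨u, hu⟩ := exists_dense_seq_eqOn
  choose g hg hgM using fun i => (hM.integral _ (u i).2).aestronglyMeasurable hW
  borelize C(unitInterval, ℝ)
  let ev : C(unitInterval, ℝ) → ℕ → ℝ := fun f i => f (u i)
  have hev : MeasurableEmbedding ev := by
    refine Continuous.measurableEmbedding
      (continuous_pi fun i => continuous_eval_const _) fun f f' h => ?_
    ext t
    have := hu (pathExtend f) (pathExtend f') (continuous_pathExtend f).continuousOn
      (continuous_pathExtend f').continuousOn
      (fun i => by
        rw [pathExtend_apply _ (u i).2, pathExtend_apply _ (u i).2]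
        exact congrFun h i) t t.2
    rwa [pathExtend_apply _ t.2, pathExtend_apply _ t.2] at this
  obtain ⟨r, hr, hre⟩ := hev.exists_measurable_extend measurable_id fun _ => ⟨0⟩
  refine ⟨fun ω => r fun i => g i ω, fun F hF => ?_, ?_⟩
  · refine Measurable.stronglyMeasurable ?_
    exact (hF.measurable.comp hr).comp
      (@measurable_pi_lambda _ _ _ (⨆ s, MeasurableSpace.comap (W s) inferInstance) _ _
        fun i => (hg i).measurable)
  · filter_upwards [ae_all_iff.2 hgM, hM.continuous_paths] with ω hω hc t ht
    let f : C(unitInterval, ℝ) := ⟨fun t => M t ω, continuousOn_iff_continuous_domRestrict.1 hc⟩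
    have hf : (fun i => g i ω) = ev f := funext fun i => (hω i).symm
    have hrf : r (ev f) = f := congrFun hre f
    rw [hf, hrf, pathExtend_apply _ ht]
    rfl

end WienerIntegral


/-! ### Measurability and Lipschitz bounds for the coefficient -/

section Coefficients

/-- The composition of a bounded Carathéodory function with a continuous path is integrable. -/
lemma intervalIntegrable_comp_path {B : ℝ → ℝ → ℝ}
    (hmeas : ∀ x, AEMeasurable (fun t => B t x) (volume.restrict (Set.Icc (0 : ℝ) 1)))
    {C : ℝ} (hbdd : ∀ t ∈ Set.Icc (0 : ℝ) 1, ∀ x, |B t x| ≤ C)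
    (hcont : ∀ t ∈ Set.Icc (0 : ℝ) 1, Continuous (B t)) {y : ℝ → ℝ} (hy : Continuous y) :
    IntervalIntegrable (fun s => B s (y s)) volume 0 1 := by
  rw [intervalIntegrable_iff_integrableOn_Icc_of_le zero_le_one]
  refine Integrable.of_bound ?_ C
    ((ae_restrict_iff' measurableSet_Icc).2 (ae_of_all _ fun t ht => hbdd t ht _))
  -- Along a simple path the composition is a finite sum of sections `B · c` cut to level sets;
  -- continuity in the space variable then passes to the limit.
  have hsimple : ∀ σ : SimpleFunc ℝ ℝ,
      AEMeasurable (fun s => B s (σ s)) (volume.restrict (Set.Icc (0 : ℝ) 1)) := by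
    intro σ
    have he : (fun s => B s (σ s))
        = fun s => ∑ c ∈ σ.range, (σ ⁻¹' {c}).indicator (fun s => B s c) s := by
      ext s
      rw [Finset.sum_eq_single (σ s)]
      · rw [Set.indicator_of_mem (by simp)]
      · intro c _ hc
        exact Set.indicator_of_notMem (fun h => hc h.symm) _
      · exact fun h => absurd (σ.mem_range_self s) h
    rw [he]
    exact Finset.aemeasurable_fun_sum _ fun c _ =>
      (hmeas c).indicator (σ.measurableSet_preimage _)
  refine aestronglyMeasurable_of_tendsto_ae atTop
    (fun n => (hsimple (hy.stronglyMeasurable.approx n)).aestronglyMeasurable)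
    ((ae_restrict_iff' measurableSet_Icc).2 (ae_of_all _ fun t ht => ?_))
  exact ((hcont t ht).tendsto _).comp (hy.stronglyMeasurable.tendsto_approx t)

lemma abs_sub_le_of_abs_deriv_le {g : ℝ → ℝ} {β : ℝ} (hg : Differentiable ℝ g)
    (hβ : ∀ x, |deriv g x| ≤ β) (x y : ℝ) : |g x - g y| ≤ β * |x - y| :=
  Convex.norm_image_sub_le_of_norm_deriv_le (fun z _ => hg z) (fun z _ => hβ z) convex_univ
    (Set.mem_univ y) (Set.mem_univ x)

end Coefficients

/-! ### Pathwise uniqueness and strong existence -/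

section Solutions

variable {Ω : Type*} [mΩ : MeasurableSpace Ω] {P : Measure Ω} {W : unitInterval → Ω → ℝ}
  {A B : ℝ → ℝ → ℝ} {f δ : ℝ → ℝ} {p k ε : ℝ} {bc : BoundaryType}

/-- The integral over `[0, t]` of the drift, rewritten in terms of the linear and the nonlinear
parts. -/
lemma integral_drift_eq (hA : ∀ t ∈ Set.Icc (0 : ℝ) 1, ∀ x, A t x = p * x + B t x)
    (hk : k ^ 2 = ε ^ 2 * p) (x : ℝ → ℝ) {t : ℝ} (ht : t ∈ Set.Icc (0 : ℝ) 1) :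
    ε ^ 2 * (∫ s in (0 : ℝ)..t, (A s (x s) + f s))
      = ∫ s in (0 : ℝ)..t, (k ^ 2 * x s + (ε ^ 2 * B s (x s) + ε ^ 2 * f s)) := by
  rw [← intervalIntegral.integral_const_mul]
  refine intervalIntegral.integral_congr fun s hs => ?_
  have hs' := uIcc_zero_subset ht hs
  rw [Set.uIcc_of_le zero_le_one] at hs'
  simp only [hA s hs', hk]
  ring

/-- The paths of a solution of the stochastic equation solve a deterministic equation driven by
the stochastic integral. -/
lemma IsSolution.ae_isPathSolution [IsProbabilityMeasure P] (hW : IsBrownianMotion P W)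
    (hδ : MemLp δ 2 (volume.restrict (Set.Icc (0 : ℝ) 1)))
    (hA : ∀ t ∈ Set.Icc (0 : ℝ) 1, ∀ x, A t x = p * x + B t x) (hk : k ^ 2 = ε ^ 2 * p)
    {M : ℝ → Ω → ℝ} (hM : IsWienerIntegralProcess P W δ M) {x : ℝ → Ω → ℝ}
    (hx : IsSolution P W A f δ ε x) (hbc : ∀ᵐ ω ∂P, bc.Holds x ω) :
    ∀ᵐ ω ∂P,
      IsPathSolution bc (fun s u => k ^ 2 * u + (ε ^ 2 * B s u + ε ^ 2 * f s))
        (fun t => ε ^ 2 * M t ω) (fun t => x t ω) (fun t => velocity x t ω) ∧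
      IntervalIntegrable (fun s => ε ^ 2 * B s (x s ω) + ε ^ 2 * f s) volume 0 1 := by
  obtain ⟨M', hM', heq⟩ := hx.equation
  -- Each solution carries its own version of the stochastic integral; replacing it by the common
  -- `M` lets two solutions be compared path by path.
  filter_upwards [hM'.indistinguishable hW hδ hM, heq, hx.contDiff, hx.integrable, hbc]
    with ω hMM he hc hi hb
  have hd : ∀ t ∈ Set.Icc (0 : ℝ) 1,
      HasDerivWithinAt (fun t => x t ω) (velocity x t ω) (Set.Icc 0 1) t := fun t ht =>
    (hc.differentiableOn one_ne_zero t ht).hasDerivWithinAt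
  refine ⟨⟨hd, fun t ht => ?_, (bc.holds_iff x ω).1 hb⟩, ?_⟩
  · rw [he t ht, hMM t ht, integral_drift_eq hA hk _ ht]
  · have h1 : IntervalIntegrable (fun s => k ^ 2 * x s ω) volume 0 1 := by
      refine ContinuousOn.intervalIntegrable ?_
      rw [Set.uIcc_of_le zero_le_one]
      exact continuousOn_const.mul hc.continuousOn
    refine ((hi.const_mul (ε ^ 2)).sub h1).congr fun s hs => ?_
    rw [Set.uIoc_of_le zero_le_one] at hs
    simp only [hA s (Set.Ioc_subset_Icc_self hs), hk]
    ring

/-- Pathwise uniqueness. -/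
theorem IsSolution.unique [IsProbabilityMeasure P] (hW : IsBrownianMotion P W)
    (hδ : MemLp δ 2 (volume.restrict (Set.Icc (0 : ℝ) 1)))
    (hA : ∀ t ∈ Set.Icc (0 : ℝ) 1, ∀ x, A t x = p * x + B t x) (hk0 : 0 < k)
    (hk : k ^ 2 = ε ^ 2 * p) {l : ℝ} (hl0 : 0 ≤ l) (hl : l < k ^ 2)
    (hlip : ∀ t ∈ Set.Icc (0 : ℝ) 1, ∀ x y, |ε ^ 2 * B t x - ε ^ 2 * B t y| ≤ l * |x - y|)
    {x y : ℝ → Ω → ℝ} (hx : IsSolution P W A f δ ε x) (hbx : ∀ᵐ ω ∂P, bc.Holds x ω)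
    (hy : IsSolution P W A f δ ε y) (hby : ∀ᵐ ω ∂P, bc.Holds y ω) :
    ∀ᵐ ω ∂P, ∀ t ∈ Set.Icc (0 : ℝ) 1, x t ω = y t ω := by
  obtain ⟨M, hM⟩ := hW.exists_isWienerIntegralProcess hδ
  filter_upwards [hx.ae_isPathSolution hW hδ hA hk hM hbx,
    hy.ae_isPathSolution hW hδ hA hk hM hby] with ω h1 h2
  exact path_solution_unique bc hk0 hl0 hl (b := fun s u => ε ^ 2 * B s u)
    (g := fun s => ε ^ 2 * f s) hlip h1.1 h2.1 h1.2 h2.2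

/-- Existence of a strong solution. -/
theorem exists_isStrongSolution [IsProbabilityMeasure P] (hW : IsBrownianMotion P W)
    (hf : IntegrableOn f (Set.Icc 0 1))
    (hδ : MemLp δ 2 (volume.restrict (Set.Icc (0 : ℝ) 1)))
    (hA : ∀ t ∈ Set.Icc (0 : ℝ) 1, ∀ x, A t x = p * x + B t x) (hk0 : 0 < k)
    (hk : k ^ 2 = ε ^ 2 * p) {l : ℝ} (hl0 : 0 ≤ l) (hl : l < k ^ 2)
    (hlip : ∀ t ∈ Set.Icc (0 : ℝ) 1, ∀ x y, |ε ^ 2 * B t x - ε ^ 2 * B t y| ≤ l * |x - y|)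
    (hB : ∀ y : ℝ → ℝ, Continuous y → IntervalIntegrable (fun s => B s (y s)) volume 0 1) :
    ∃ x, IsStrongSolution P W A f δ ε x ∧ ∀ᵐ ω ∂P, bc.Holds x ω := by
  have hf' : IntervalIntegrable f volume 0 1 :=
    (intervalIntegrable_iff_integrableOn_Icc_of_le zero_le_one).2 hf
  obtain ⟨M, hM⟩ := hW.exists_isWienerIntegralProcess hδ
  obtain ⟨G, hGm, hG⟩ := hM.exists_path hW
  obtain ⟨Φ, hΦc, hΦ⟩ := exists_solutionMap bc hk0 hl0 hl (b := fun s u => ε ^ 2 * B s u)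
    (fun y hy => (hB y hy).const_mul _) hlip
  let J : C(unitInterval, ℝ) := ⟨fun t => ∫ s in (0 : ℝ)..t, f s, by
    have := (continuous_primitive hf').comp
      (continuous_subtype_val (p := (· ∈ Set.Icc (0 : ℝ) 1)))
    refine this.congr fun t => ?_
    exact Set.IccExtend_val _ _ t⟩
  let N : C(unitInterval, ℝ) → C(unitInterval, ℝ) := fun g => ε ^ 2 • (J + g)
  have hNc : Continuous N := by fun_prop
  let X : Ω → C(unitInterval, ℝ) := fun ω => Φ (N (G ω))
  have hpath : ∀ᵐ ω ∂P, ∃ v, Continuous v ∧ (∀ t ∈ Set.Icc (0 : ℝ) 1,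
      HasDerivWithinAt (pathExtend (X ω)) (v t) (Set.Icc 0 1) t) ∧
      bc.Cond (pathExtend (X ω) 0) (pathExtend (X ω) 1) (v 0) (v 1) ∧
      ∀ t ∈ Set.Icc (0 : ℝ) 1, v t = v 0
        + ε ^ 2 * (∫ s in (0 : ℝ)..t, (A s (pathExtend (X ω) s) + f s)) + ε ^ 2 * M t ω := by
    filter_upwards [hG, hM.start hW hδ] with ω hω h0
    obtain ⟨v, hv, hs⟩ := hΦ (N (G ω))
    refine ⟨v, hv, hs.hasDeriv, hs.cond, fun t ht => ?_⟩
    have hN : ∀ t (ht : t ∈ Set.Icc (0 : ℝ) 1),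
        N (G ω) ⟨t, ht⟩ = ε ^ 2 * ((∫ s in (0 : ℝ)..t, f s) + M t ω) := fun t ht => by
      rw [← hω t ht, pathExtend_apply _ ht]
      rfl
    -- Since `M` starts at zero almost surely, the recentring built into the solution map has no
    -- effect here.
    have hN0 : N (G ω) 0 = 0 := by
      have := hN 0 ⟨le_rfl, zero_le_one⟩
      rw [intervalIntegral.integral_same, h0, add_zero, mul_zero] at this
      exact this
    have hxi : IntervalIntegrable (fun s => k ^ 2 * pathExtend (X ω) s
        + ε ^ 2 * B s (pathExtend (X ω) s)) volume 0 t :=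
      (((continuous_const.mul (continuous_pathExtend _)).intervalIntegrable 0 1).add
        ((hB _ (continuous_pathExtend _)).const_mul _)).mono_set (uIcc_zero_subset ht)
    have hfi : IntervalIntegrable (fun s => ε ^ 2 * f s) volume 0 t :=
      (hf'.const_mul _).mono_set (uIcc_zero_subset ht)
    rw [hs.equation t ht, hN0, pathExtend_apply _ ht, hN, integral_drift_eq hA hk _ ht]
    simp only [← add_assoc]
    rw [intervalIntegral.integral_add hxi hfi, intervalIntegral.integral_const_mul]
    simp only [X]
    ring
  have hvel : ∀ (ω : Ω) (v : ℝ → ℝ), (∀ t ∈ Set.Icc (0 : ℝ) 1,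
      HasDerivWithinAt (pathExtend (X ω)) (v t) (Set.Icc 0 1) t) → ∀ t ∈ Set.Icc (0 : ℝ) 1,
      velocity (fun t ω => pathExtend (X ω) t) t ω = v t := fun ω v h t ht =>
    (h t ht).derivWithin (uniqueDiffOn_Icc zero_lt_one t ht)
  -- The value at `t` is a continuous functional of `G ω`, so it inherits measurability with respect
  -- to `W`.
  have hsm : ∀ t, StronglyMeasurable[⨆ s : unitInterval,
      MeasurableSpace.comap (W s) inferInstance] fun ω => pathExtend (X ω) t := fun t =>
    hGm (fun g => pathExtend (Φ (N g)) t)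
      ((continuous_eval_const (Set.projIcc 0 1 zero_le_one t)).comp (hΦc.comp hNc))
  have hle : (⨆ s : unitInterval, MeasurableSpace.comap (W s) inferInstance) ≤ mΩ :=
    iSup_le fun s => (hW.measurable s).comap_le
  refine ⟨fun t ω => pathExtend (X ω) t,
    ⟨⟨fun t _ => ((hsm t).mono hle).measurable.aemeasurable, ?_, ?_, M, hM, ?_⟩,
      fun t _ => (hsm t).aestronglyMeasurable⟩, ?_⟩
  · filter_upwards [hpath] with ω ⟨v, hv, hd, _, _⟩
    refine (contDiffOn_one_iff_derivWithin (uniqueDiffOn_Icc zero_lt_one)).2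
      ⟨fun t ht => (hd t ht).differentiableWithinAt, ?_⟩
    exact hv.continuousOn.congr fun t ht => hvel ω v hd t ht
  · refine ae_of_all _ fun ω => ?_
    have h1 := ((continuous_const.mul (continuous_pathExtend (X ω))).intervalIntegrable
      (μ := volume) 0 1 (u := fun s => p * pathExtend (X ω) s)).add
      (hB _ (continuous_pathExtend (X ω)))
    refine (h1.congr fun s hs => ?_).add hf'
    rw [Set.uIoc_of_le zero_le_one] at hs
    exact (hA s (Set.Ioc_subset_Icc_self hs) _).symm
  · filter_upwards [hpath] with ω ⟨v, hv, hd, _, he⟩ t ht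
    rw [hvel ω v hd t ht, hvel ω v hd 0 ⟨le_rfl, zero_le_one⟩]
    exact he t ht
  · filter_upwards [hpath] with ω ⟨v, hv, hd, hc, _⟩
    rw [bc.holds_iff, hvel ω v hd 0 ⟨le_rfl, zero_le_one⟩, hvel ω v hd 1 ⟨zero_le_one, le_rfl⟩]
    exact hc

end Solutions

end StochBVP

theorem theorem2p1 (A B : ℝ → ℝ → ℝ) (p : ℝ) (hp : 0 < p)
    (hA : ∀ t ∈ Set.Icc (0 : ℝ) 1, ∀ x, A t x = p * x + B t x)
    (hB_meas : ∀ x, AEMeasurable (fun t => B t x) (volume.restrict (Set.Icc (0 : ℝ) 1)))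
    (hB_bdd : ∃ C : ℝ, ∀ t ∈ Set.Icc (0 : ℝ) 1, ∀ x, |B t x| ≤ C)
    (hB_diff : ∀ t ∈ Set.Icc (0 : ℝ) 1, Differentiable ℝ (B t))
    (hB_deriv : ∃ β < p, ∀ t ∈ Set.Icc (0 : ℝ) 1, ∀ x, |deriv (B t) x| ≤ β)
    (hB_unif : ∀ η > 0, ∃ r > 0, ∀ t ∈ Set.Icc (0 : ℝ) 1, ∀ x y : ℝ, |x - y| ≤ r →
      |deriv (B t) x - deriv (B t) y| ≤ η) :
    ∃ ε₀ : ℝ, 0 < ε₀ ∧ ∀ ε : ℝ, 0 < ε → ε ≤ ε₀ → ∀ bc : StochBVP.BoundaryType,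
      ∀ f δ : ℝ → ℝ, IntegrableOn f (Set.Icc 0 1) →
        MemLp δ 2 (volume.restrict (Set.Icc (0 : ℝ) 1)) →
      ∀ (Ω : Type*) [MeasurableSpace Ω] (P : Measure Ω) [IsProbabilityMeasure P]
        (W : unitInterval → Ω → ℝ), StochBVP.IsBrownianMotion P W →
      (∃ x : ℝ → Ω → ℝ, StochBVP.IsStrongSolution P W A f δ ε x ∧ ∀ᵐ ω ∂P, bc.Holds x ω) ∧
      (∀ x y : ℝ → Ω → ℝ,
        StochBVP.IsSolution P W A f δ ε x → (∀ᵐ ω ∂P, bc.Holds x ω) →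
        StochBVP.IsSolution P W A f δ ε y → (∀ᵐ ω ∂P, bc.Holds y ω) →
        ∀ᵐ ω ∂P, ∀ t ∈ Set.Icc (0 : ℝ) 1, x t ω = y t ω) := by
  obtain ⟨C, hC⟩ := hB_bdd
  obtain ⟨β, hβp, hβ⟩ := hB_deriv
  have hβ0 : 0 ≤ β := (abs_nonneg _).trans (hβ 0 ⟨le_rfl, zero_le_one⟩ 0)
  -- The contraction ratio ε²β/(ε²p) = β/p is free of ε, so any positive threshold would do.
  refine ⟨1, one_pos, fun ε hε _ bc f δ hf hδ Ω _ P _ W hW => ?_⟩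
  have hk : (ε * √p) ^ 2 = ε ^ 2 * p := by rw [mul_pow, Real.sq_sqrt hp.le]
  have hk0 : 0 < ε * √p := mul_pos hε (Real.sqrt_pos.2 hp)
  have hε2 : 0 < ε ^ 2 := by positivity
  have hl0 : 0 ≤ ε ^ 2 * β := by positivity
  have hl : ε ^ 2 * β < (ε * √p) ^ 2 := by
    rw [hk]
    exact mul_lt_mul_of_pos_left hβp hε2
  have hlip : ∀ t ∈ Set.Icc (0 : ℝ) 1, ∀ x y,
      |ε ^ 2 * B t x - ε ^ 2 * B t y| ≤ ε ^ 2 * β * |x - y| := fun t ht x y => by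
    rw [← mul_sub, abs_mul, abs_of_pos hε2, mul_assoc]
    exact mul_le_mul_of_nonneg_left
      (StochBVP.abs_sub_le_of_abs_deriv_le (hB_diff t ht) (hβ t ht) x y) hε2.le
  exact ⟨StochBVP.exists_isStrongSolution hW hf hδ hA hk0 hk hl0 hl hlip fun y hy =>
      StochBVP.intervalIntegrable_comp_path hB_meas hC (fun t ht => (hB_diff t ht).continuous) hy,
    fun x y hx hbx hy hby => hx.unique hW hδ hA hk0 hk hl0 hl hlip hbx hy hby⟩
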